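/- Conventions. $[\mathcal H_1,\mathcal H_2]$ denotes the bounded linear operators between complex Hilbert spaces, $[\mathcal H]=[\mathcal H,\mathcal H]$; for $B\in[\mathcal H]$, $B_R=\frac12(B+B^*)$ and $B_I=\operatorname{Im}B=\frac1{2i}(B-B^*)$; $\rho(T)$ is the resolvent set of an operator $T$. Let $A$ be a closed densely defined symmetric operator in a separable Hilbert space $H$. A boundary triplet $\{\mathcal H,\Gamma_0,\Gamma_1\}$ for $A^*$ consists of a Hilbert space $\mathcal H$ and linear maps $\Gamma_0,\Gamma_1:\operatorname{dom}A^*\to\mathcal H$ such that $(A^*f,g)-(f,A^*g)=(\Gamma_1f,\Gamma_0g)-(\Gamma_0f,\Gamma_1g)$ for all $f,g\in\operatorname{dom}A^*$ and $f\mapsto(\Gamma_1f,\Gamma_0f)$ maps $\operatorname{dom}A^*$ onto $\mathcal H\oplus\mathcal H$. Put $A_0=A^*|_{\ker\Gamma_0}$ and, for $B\in[\mathcal H]$, $A_B=A^*|_{\ker(\Gamma_1-B\Gamma_0)}$. The Weyl function is the function $M:\rho(A_0)\to[\mathcal H]$ with $M(z)\Gamma_0f=\Gamma_1f$ for all $f\in\ker(A^*-z)$.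 Let $\mathcal E$ be a Hilbert space and $J=J^*=J^{-1}\in[\mathcal E]$. An operator $U\in[\mathcal E]$ is $J$-unitary if $U^*JU=J=UJU^*$. Let $Z\subseteq\mathbb C$ be a nonempty open set. A holomorphic function $W:Z\to[\mathcal E]$ belongs to $\Lambda^0_J$ if there are $A$, a boundary triplet $\{\mathcal H,\Gamma_0,\Gamma_1\}$ for $A^*$ with Weyl function $M$, and operators $B\in[\mathcal H]$, $K\in[\mathcal E,\mathcal H]$ with $B_I=KJK^*$, $\ker K^*=\{0\}$ and $Z\subseteq\rho(A_{B^*})$, such that $$W(z)=I+2iK^*(B^*-M(z))^{-1}KJ\qquad(z\in Z\cap\rho(A_0)).$$ Given such a representation of $W$, put $V(z)=K^*(B_R-M(z))^{-1}K$ for nonreal $z$, and fix $z_0$ with $\operatorname{Im}z_0>0$. Then $\operatorname{Im}V(z_0)\ge0$. Let $\mathcal E^W_-$ be the completion of $\mathcal E$ in the norm $\|f\|_-=(\operatorname{Im}V(z_0)f,f)^{1/2}$ (the Hausdorff completion, in case this is only a seminorm), and let $\mathcal E^W_+$ be the dual of $\mathcal E^W_-$ with respect to the inner product of $\mathcal E$,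 that is, the space of all $v\in\mathcal E$ for which $\|v\|_+=\sup\{|(u,v)|:u\in\mathcal E,\ \|u\|_-\le1\}$ is finite, with the norm $\|\cdot\|_+$. **Theorem.** Let $W_0\in\Lambda^0_J$ on $Z$, let $U_1,U_2$ be $J$-unitary operators in $\mathcal E$, and let $\mathcal E^{W_0}_\pm$ be the spaces given by any representation of $W_0$ as above and any $z_0$ in the upper half-plane. Then the function $W(z)=U_1W_0(z)U_2$ belongs to $\Lambda^0_J$ on $Z$ if and only if both of the following hold: (a) $U_2U_1$ restricts to a topological isomorphism of $\mathcal E^{W_0}_+$ onto itself; (b) $(U_2U_1-I)J\in[\mathcal E^{W_0}_-,\mathcal E^{W_0}_+]$, that is, there is a bounded operator $T:\mathcal E^{W_0}_-\to\mathcal E^{W_0}_+$ such that $T\hat f=(U_2U_1-I)Jf$ for all $f\in\mathcal E$, where $\hat f$ is the image of $f$ in $\mathcal E^{W_0}_-$. -/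

import Mathlib

open scoped InnerProductSpace ComplexConjugate LinearPMap

universe u v w

noncomputable section

namespace DM

/-! ### Symmetric operators, boundary triplets and Weyl functions -/

section Operators

variable {H : Type v} [NormedAddCommGroup H] [InnerProductSpace ℂ H]

/-- The resolvent set `ρ(T)` of a (possibly unbounded) operator `T` in `H`: the set of all `z` for
which `T - z` is a bijection of `dom T` onto `H` with an everywhere defined bounded inverse. -/
def resolventSet (T : H →ₗ.[ℂ] H) : Set ℂ :=
  {z | ∃ R : H →L[ℂ] H,
    (∀ y : H, ∃ x : T.domain, (x : H) = R y ∧ T x - z • (x : H) = y) ∧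
    (∀ x : T.domain, R (T x - z • (x : H)) = x)}

/-- `A` is a closed, densely defined, symmetric operator in `H`. -/
structure IsClosedSymmetric (A : H →ₗ.[ℂ] H) : Prop where
  dense : Dense (A.domain : Set H)
  closed : A.IsClosed
  symmetric : ∀ x y : A.domain, ⟪A x, (y : H)⟫_ℂ = ⟪(x : H), A y⟫_ℂ

variable [CompleteSpace H]

/-- A boundary triplet `{𝓗, Γ₀, Γ₁}` for the adjoint `A†`. Mathlib's inner product is
conjugate-linear in the first variable, so `(f, g)` is written `⟪g, f⟫`. -/
structure BoundaryTriplet (A : H →ₗ.[ℂ] H) (𝓗 : Type w) [NormedAddCommGroup 𝓗]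
    [InnerProductSpace ℂ 𝓗] where
  Γ₀ : A†.domain →ₗ[ℂ] 𝓗
  Γ₁ : A†.domain →ₗ[ℂ] 𝓗
  green : ∀ f g : A†.domain,
    ⟪(g : H), A† f⟫_ℂ - ⟪A† g, (f : H)⟫_ℂ = ⟪Γ₀ g, Γ₁ f⟫_ℂ - ⟪Γ₁ g, Γ₀ f⟫_ℂ
  surjective : ∀ h₁ h₀ : 𝓗, ∃ f : A†.domain, Γ₁ f = h₁ ∧ Γ₀ f = h₀

namespace BoundaryTriplet

variable {A : H →ₗ.[ℂ] H} {𝓗 : Type w} [NormedAddCommGroup 𝓗] [InnerProductSpace ℂ 𝓗]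

/-- The extension `A₀` of `A`: the restriction of `A†` to `ker Γ₀`. -/
def ext₀ (P : BoundaryTriplet A 𝓗) : H →ₗ.[ℂ] H :=
  A†.domRestrict ((LinearMap.ker P.Γ₀).map A†.domain.subtype)

/-- The almost solvable extension `A_B` of `A`: the restriction of `A†` to `ker (Γ₁ - B Γ₀)`. -/
def ext (P : BoundaryTriplet A 𝓗) (B : 𝓗 →L[ℂ] 𝓗) : H →ₗ.[ℂ] H :=
  A†.domRestrict
    ((LinearMap.ker (P.Γ₁ - (B : 𝓗 →ₗ[ℂ] 𝓗) ∘ₗ P.Γ₀)).map A†.domain.subtype)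

/-- `T` satisfies `T Γ₀ f = Γ₁ f` for all `f` in the defect subspace `ker (A† - z)`. -/
def IsWeylAt (P : BoundaryTriplet A 𝓗) (z : ℂ) (T : 𝓗 →L[ℂ] 𝓗) : Prop :=
  ∀ f : A†.domain, A† f = z • (f : H) → T (P.Γ₀ f) = P.Γ₁ f

open scoped Classical in
/-- The Weyl function `M(z)`: the bounded operator with `M(z) Γ₀ f = Γ₁ f` for all
`f ∈ ker (A† - z)`; it is used for `z ∈ ρ(A₀)` only, where such an operator exists and is
unique. -/
def weyl (P : BoundaryTriplet A 𝓗) (z : ℂ) : 𝓗 →L[ℂ] 𝓗 :=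
  if h : ∃ T : 𝓗 →L[ℂ] 𝓗, P.IsWeylAt z T then h.choose else 0

lemma Γ₀_eq_zero_of_forall (P : BoundaryTriplet A 𝓗) (g : A†.domain)
    (h : ∀ f : A†.domain, P.Γ₀ f = 0 → ⟪(f : H), A† g⟫_ℂ = ⟪A† f, (g : H)⟫_ℂ) :
    P.Γ₀ g = 0 := by
  obtain ⟨f, hf₁, hf₀⟩ := P.surjective (P.Γ₀ g) 0
  have h1 := P.green g f
  rw [h f hf₀, hf₀, hf₁] at h1
  simpa using h1

lemma eq_zero_of_mem_ker (P : BoundaryTriplet A 𝓗) {z : ℂ} (hz : z.im ≠ 0) (f : A†.domain)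
    (h₀ : P.Γ₀ f = 0) (hf : A† f = z • (f : H)) : (f : H) = 0 := by
  have h1 := P.green f f
  rw [h₀, hf, inner_smul_left, inner_smul_right] at h1
  simp only [inner_zero_left, inner_zero_right, sub_zero] at h1
  rw [← sub_mul, Complex.sub_conj] at h1
  rcases mul_eq_zero.1 h1 with h2 | h2
  · simp [hz] at h2
  · exact inner_self_eq_zero.1 h2

/-- The graph of `A₀`, described by conditions that make its closedness evident. -/
def graph₀ (P : BoundaryTriplet A 𝓗) : Submodule ℂ (H × H) where
  carrier := {p | (∀ g : A.domain, ⟪A g, p.1⟫_ℂ = ⟪(g : H), p.2⟫_ℂ) ∧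
    ∀ g : A†.domain, P.Γ₀ g = 0 → ⟪A† g, p.1⟫_ℂ = ⟪(g : H), p.2⟫_ℂ}
  zero_mem' := by simp
  add_mem' := by
    rintro p q ⟨hp, hp'⟩ ⟨hq, hq'⟩
    refine ⟨fun g => ?_, fun g hg => ?_⟩
    · rw [Prod.fst_add, Prod.snd_add, inner_add_right, inner_add_right, hp g, hq g]
    · rw [Prod.fst_add, Prod.snd_add, inner_add_right, inner_add_right, hp' g hg, hq' g hg]
  smul_mem' := by
    rintro c p ⟨hp, hp'⟩
    refine ⟨fun g => ?_, fun g hg => ?_⟩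
    · rw [Prod.smul_fst, Prod.smul_snd, inner_smul_right, inner_smul_right, hp g]
    · rw [Prod.smul_fst, Prod.smul_snd, inner_smul_right, inner_smul_right, hp' g hg]

lemma isClosed_graph₀ (P : BoundaryTriplet A 𝓗) : IsClosed (P.graph₀ : Set (H × H)) := by
  have : (P.graph₀ : Set (H × H)) =
      (⋂ g : A.domain, {p : H × H | ⟪A g, p.1⟫_ℂ = ⟪(g : H), p.2⟫_ℂ}) ∩
      ⋂ g : A†.domain, ⋂ _ : P.Γ₀ g = 0,
        {p : H × H | ⟪A† g, p.1⟫_ℂ = ⟪(g : H), p.2⟫_ℂ} := by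
    ext p
    simp [graph₀]
  rw [this]
  refine IsClosed.inter (isClosed_iInter fun g => ?_)
    (isClosed_iInter fun g => isClosed_iInter fun _ => ?_)
  · exact isClosed_eq (by fun_prop) (by fun_prop)
  · exact isClosed_eq (by fun_prop) (by fun_prop)

lemma exists_of_mem_graph₀ (P : BoundaryTriplet A 𝓗) (hA : IsClosedSymmetric A) {p : H × H}
    (hp : p ∈ P.graph₀) :
    ∃ f : A†.domain, (f : H) = p.1 ∧ A† f = p.2 ∧ P.Γ₀ f = 0 := by
  obtain ⟨h1, h2⟩ := hp
  have h3 : ∀ g : A.domain, ⟪p.2, (g : H)⟫_ℂ = ⟪p.1, A g⟫_ℂ := fun g => by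
    rw [← inner_conj_symm, ← h1 g, inner_conj_symm]
  have hd : p.1 ∈ A†.domain := LinearPMap.mem_adjoint_domain_of_exists _ ⟨p.2, h3⟩
  have he : A† ⟨p.1, hd⟩ = p.2 := LinearPMap.adjoint_apply_eq hA.dense _ h3
  refine ⟨⟨p.1, hd⟩, rfl, he, P.Γ₀_eq_zero_of_forall _ fun f hf => ?_⟩
  rw [he]
  exact (h2 f hf).symm

lemma mem_graph₀ (P : BoundaryTriplet A 𝓗) (hA : IsClosedSymmetric A) {f : A†.domain}
    (hf : P.Γ₀ f = 0) : ((f : H), A† f) ∈ P.graph₀ := by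
  refine ⟨fun g => ?_, fun g hg => ?_⟩
  · have := LinearPMap.adjoint_isFormalAdjoint hA.dense f g
    rw [← inner_conj_symm, ← this, inner_conj_symm]
  · have := P.green f g
    rw [hf, hg] at this
    simp only [inner_zero_left, inner_zero_right, sub_zero] at this
    exact (sub_eq_zero.1 this).symm

lemma Γ₀_eq_zero_of_mem_domain (P : BoundaryTriplet A 𝓗) (hA : IsClosedSymmetric A)
    (g : A.domain) : ∃ f : A†.domain, (f : H) = g ∧ A† f = A g ∧ P.Γ₀ f = 0 := by
  have h3 : ∀ x : A.domain, ⟪A g, (x : H)⟫_ℂ = ⟪(g : H), A x⟫_ℂ := hA.symmetric g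
  have hd : (g : H) ∈ A†.domain := LinearPMap.mem_adjoint_domain_of_exists _ ⟨A g, h3⟩
  have he : A† ⟨g, hd⟩ = A g := LinearPMap.adjoint_apply_eq hA.dense _ h3
  refine ⟨⟨g, hd⟩, rfl, he, P.Γ₀_eq_zero_of_forall _ fun f _ => ?_⟩
  rw [he]
  exact (LinearPMap.adjoint_isFormalAdjoint hA.dense f g).symm

lemma norm_le_of_mem_graph₀ (P : BoundaryTriplet A 𝓗) (hA : IsClosedSymmetric A) (z : ℂ)
    {p : H × H} (hp : p ∈ P.graph₀) : |z.im| * ‖p.1‖ ≤ ‖p.2 - z • p.1‖ := by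
  obtain ⟨f, hf1, hf2, hf0⟩ := P.exists_of_mem_graph₀ hA hp
  have h1 : ⟪p.1, p.2⟫_ℂ = ⟪p.2, p.1⟫_ℂ := by
    have := P.green f f
    rw [hf0, hf1, hf2] at this
    simp only [inner_zero_left, inner_zero_right, sub_zero] at this
    exact sub_eq_zero.1 this
  have him : (⟪p.1, p.2⟫_ℂ).im = 0 := by
    have h2 := inner_conj_symm (𝕜 := ℂ) p.1 p.2
    rw [← h1] at h2
    exact Complex.conj_eq_iff_im.1 h2
  have h3 : (⟪p.1, p.2 - z • p.1⟫_ℂ).im = - (z.im * ‖p.1‖ ^ 2) := by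
    rw [inner_sub_right, inner_smul_right, inner_self_eq_norm_sq_to_K, Complex.sub_im, him]
    simp [← Complex.ofReal_pow]
  have h4 : |z.im| * ‖p.1‖ ^ 2 ≤ ‖p.1‖ * ‖p.2 - z • p.1‖ := by
    calc |z.im| * ‖p.1‖ ^ 2 = |(⟪p.1, p.2 - z • p.1⟫_ℂ).im| := by
          rw [h3, abs_neg, abs_mul, abs_of_nonneg (sq_nonneg ‖p.1‖)]
      _ ≤ ‖⟪p.1, p.2 - z • p.1⟫_ℂ‖ := Complex.abs_im_le_norm _
      _ ≤ _ := norm_inner_le_norm _ _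
  rcases (norm_nonneg p.1).eq_or_lt with h5 | h5
  · rw [← h5]; simp
  · refine le_of_mul_le_mul_left ?_ h5
    nlinarith

lemma exists_sub_smul_eq (P : BoundaryTriplet A 𝓗) (hA : IsClosedSymmetric A) {z : ℂ}
    (hz : z.im ≠ 0) (y : H) :
    ∃ f : A†.domain, P.Γ₀ f = 0 ∧ A† f - z • (f : H) = y := by
  have hcomp : CompleteSpace P.graph₀ := P.isClosed_graph₀.completeSpace_coe
  let φ : P.graph₀ →L[ℂ] H :=
    (ContinuousLinearMap.snd ℂ H H - z • ContinuousLinearMap.fst ℂ H H).comp P.graph₀.subtypeL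
  have hφ : ∀ p : P.graph₀, φ p = (p : H × H).2 - z • (p : H × H).1 := fun p => rfl
  have hzpos : 0 < |z.im| := abs_pos.2 hz
  let C : NNReal := ⟨1 + (1 + ‖z‖) / |z.im|, by positivity⟩
  have hanti : AntilipschitzWith C φ := by
    refine AddMonoidHomClass.antilipschitz_of_bound φ fun p => ?_
    have h1 := P.norm_le_of_mem_graph₀ hA z p.2
    rw [← hφ p] at h1
    have h1' : ‖(p : H × H).1‖ ≤ ‖φ p‖ / |z.im| := by
      rw [le_div_iff₀ hzpos, mul_comm]; exact h1
    have h2 : ‖(p : H × H).2‖ ≤ ‖φ p‖ + ‖z‖ * ‖(p : H × H).1‖ := by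
      calc ‖(p : H × H).2‖ = ‖φ p + z • (p : H × H).1‖ := by rw [hφ]; simp
        _ ≤ _ := (norm_add_le _ _).trans (by rw [norm_smul])
    have h3 : (C : ℝ) * ‖φ p‖ = ‖φ p‖ + ‖φ p‖ / |z.im| + ‖z‖ * (‖φ p‖ / |z.im|) := by
      change (1 + (1 + ‖z‖) / |z.im|) * ‖φ p‖ = _
      ring
    have h4 : ‖z‖ * ‖(p : H × H).1‖ ≤ ‖z‖ * (‖φ p‖ / |z.im|) := by gcongr
    have h5 : 0 ≤ ‖φ p‖ / |z.im| := by positivity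
    have h6 : 0 ≤ ‖z‖ * (‖φ p‖ / |z.im|) := by positivity
    rw [h3]
    change max ‖(p : H × H).1‖ ‖(p : H × H).2‖ ≤ _
    have h7 := norm_nonneg (φ p)
    exact max_le (by linarith) (by linarith)
  have hclosed : IsClosed (LinearMap.range (φ : P.graph₀ →ₗ[ℂ] H) : Set H) := by
    have h := hanti.isClosed_range φ.uniformContinuous
    exact h
  have htop : LinearMap.range (φ : P.graph₀ →ₗ[ℂ] H) = ⊤ := by
    have : CompleteSpace (LinearMap.range (φ : P.graph₀ →ₗ[ℂ] H)) :=
      hclosed.completeSpace_coe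
    rw [← Submodule.orthogonal_eq_bot_iff, Submodule.eq_bot_iff]
    intro w hw
    rw [Submodule.mem_orthogonal] at hw
    have h1 : ∀ f : A†.domain, P.Γ₀ f = 0 → ⟪A† f, w⟫_ℂ = ⟪(f : H), conj z • w⟫_ℂ := by
      intro f hf
      have := hw (φ ⟨_, P.mem_graph₀ hA hf⟩) ⟨_, rfl⟩
      rw [hφ] at this
      simp only [inner_sub_left, inner_smul_left] at this
      rw [inner_smul_right]
      exact sub_eq_zero.1 this
    have h2 : (w, conj z • w) ∈ P.graph₀ := by
      refine ⟨fun g => ?_, h1⟩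
      obtain ⟨f, hf1, hf2, hf0⟩ := P.Γ₀_eq_zero_of_mem_domain hA g
      rw [← hf1, ← hf2]
      exact h1 f hf0
    obtain ⟨f, hf1, hf2, hf0⟩ := P.exists_of_mem_graph₀ hA h2
    have h3 := P.eq_zero_of_mem_ker (z := conj z) (by simpa using hz) f hf0
      (by rw [hf2, hf1])
    rw [← h3, hf1]
  obtain ⟨p, hp⟩ : y ∈ LinearMap.range (φ : P.graph₀ →ₗ[ℂ] H) := htop ▸ Submodule.mem_top
  obtain ⟨f, hf1, hf2, hf0⟩ := P.exists_of_mem_graph₀ hA p.2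
  refine ⟨f, hf0, ?_⟩
  rw [hf1, hf2, ← hφ]
  exact hp

/-- `Γ₀` maps the defect subspace `ker (A† - z)` onto `𝓗`. -/
lemma exists_mem_defect (P : BoundaryTriplet A 𝓗) (hA : IsClosedSymmetric A) {z : ℂ}
    (hz : z.im ≠ 0) (h : 𝓗) : ∃ f : A†.domain, P.Γ₀ f = h ∧ A† f = z • (f : H) := by
  obtain ⟨f, -, hf⟩ := P.surjective 0 h
  obtain ⟨g, hg0, hg⟩ := P.exists_sub_smul_eq hA hz (A† f - z • (f : H))
  refine ⟨f - g, by rw [map_sub, hg0, hf, sub_zero], ?_⟩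
  rw [LinearPMap.map_sub, Submodule.coe_sub, smul_sub]
  linear_combination (norm := module) -hg

lemma im_weyl_nonneg (P : BoundaryTriplet A 𝓗) (hA : IsClosedSymmetric A) {z : ℂ}
    (hz : 0 < z.im) (h : 𝓗) : 0 ≤ (⟪h, P.weyl z h⟫_ℂ).im := by
  unfold weyl
  split_ifs with hT
  · obtain ⟨f, rfl, hf⟩ := P.exists_mem_defect hA hz.ne' h
    rw [hT.choose_spec f hf]
    have h1 := P.green f f
    rw [hf, inner_smul_left, inner_smul_right, ← sub_mul, Complex.sub_conj,
      inner_self_eq_norm_sq_to_K, ← inner_conj_symm (P.Γ₁ f), Complex.sub_conj] at h1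
    have h2 := congrArg Complex.im h1
    simp [← Complex.ofReal_pow] at h2
    nlinarith [mul_nonneg hz.le (sq_nonneg ‖(f : H)‖)]
  · simp

end BoundaryTriplet

end Operators

/-! ### The classes `Λ_J` and `Λ⁰_J` -/

section Classes

variable {E : Type u} [NormedAddCommGroup E] [InnerProductSpace ℂ E] [CompleteSpace E]

/-- `J = J* = J⁻¹`: a signature operator. -/
def IsSignature (J : E →L[ℂ] E) : Prop :=
  star J = J ∧ J * J = 1

/-- `U` is a `J`-unitary operator. -/
def IsJUnitary (J U : E →L[ℂ] E) : Prop :=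
  star U * J * U = J ∧ U * J * star U = J

/-- A representation `W(z) = I + 2i K* (B* - M(z))⁻¹ K J` of a holomorphic operator function `W` on
`Z ⊆ ρ(A_{B*})` as the characteristic function of an almost solvable extension `A_B`: here `M` is
the Weyl function of a boundary triplet for `A†`, and `(B, 𝓗, K, E, J)` is an operator colligation,
that is, `Im B = K J K*`. The right-hand side makes sense where `M` does, that is, on
`Z ∩ ρ(A₀)`, which contains all nonreal points of `Z`. -/
structure LambdaRepr (H : Type v) [NormedAddCommGroup H] [InnerProductSpace ℂ H] [CompleteSpace H]
    (𝓗 : Type w) [NormedAddCommGroup 𝓗] [InnerProductSpace ℂ 𝓗] [CompleteSpace 𝓗]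
    (J : E →L[ℂ] E) (Z : Set ℂ) (W : ℂ → E →L[ℂ] E) where
  A : H →ₗ.[ℂ] H
  isClosedSymmetric : IsClosedSymmetric A
  triplet : BoundaryTriplet A 𝓗
  B : 𝓗 →L[ℂ] 𝓗
  K : E →L[ℂ] 𝓗
  im_B : (imaginaryPart B : 𝓗 →L[ℂ] 𝓗) = K ∘L J ∘L K.adjoint
  isOpen : IsOpen Z
  nonempty : Z.Nonempty
  subset_resolventSet : Z ⊆ resolventSet (triplet.ext (star B))
  differentiableOn : DifferentiableOn ℂ W Z
  eq_on : ∀ z ∈ Z ∩ resolventSet triplet.ext₀,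
    W z = 1 + (2 * Complex.I) •
      (K.adjoint ∘L Ring.inverse (star B - triplet.weyl z) ∘L K ∘L J)

/-- The class `Λ⁰_J` of operator functions on `Z`: those that have a representation as above, over
a separable Hilbert space `H`, with `ker K* = {0}`. -/
def InLambda0 (J : E →L[ℂ] E) (Z : Set ℂ) (W : ℂ → E →L[ℂ] E) : Prop :=
  ∃ (H : Type v) (_ : NormedAddCommGroup H) (_ : InnerProductSpace ℂ H) (_ : CompleteSpace H)
    (_ : TopologicalSpace.SeparableSpace H)
    (𝓗 : Type w) (_ : NormedAddCommGroup 𝓗) (_ : InnerProductSpace ℂ 𝓗) (_ : CompleteSpace 𝓗)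
    (R : LambdaRepr H 𝓗 J Z W), R.K.adjoint.ker = ⊥

namespace LambdaRepr

variable {H : Type v} [NormedAddCommGroup H] [InnerProductSpace ℂ H] [CompleteSpace H]
  {𝓗 : Type w} [NormedAddCommGroup 𝓗] [InnerProductSpace ℂ 𝓗] [CompleteSpace 𝓗]
  {J : E →L[ℂ] E} {Z : Set ℂ} {W : ℂ → E →L[ℂ] E}

/-- `V(z) = K* (Re B - M(z))⁻¹ K`. -/
def V (R : LambdaRepr H 𝓗 J Z W) (z : ℂ) : E →L[ℂ] E :=
  R.K.adjoint ∘L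
    Ring.inverse ((realPart R.B : 𝓗 →L[ℂ] 𝓗) - R.triplet.weyl z) ∘L R.K

/-- `Im V(z)`. -/
def imV (R : LambdaRepr H 𝓗 J Z W) (z : ℂ) : E →L[ℂ] E :=
  (imaginaryPart (R.V z) : E →L[ℂ] E)

lemma im_V_nonneg (R : LambdaRepr H 𝓗 J Z W) {z : ℂ} (hz : 0 < z.im) (u : E) :
    0 ≤ (⟪u, R.V z u⟫_ℂ).im := by
  set N : 𝓗 →L[ℂ] 𝓗 := (realPart R.B : 𝓗 →L[ℂ] 𝓗) - R.triplet.weyl z with hN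
  have h1 : ⟪u, R.V z u⟫_ℂ = ⟪R.K u, Ring.inverse N (R.K u)⟫_ℂ := by
    simp [V, ← hN, ContinuousLinearMap.adjoint_inner_right]
  rw [h1]
  by_cases hu : IsUnit N
  · set x := Ring.inverse N (R.K u) with hx
    have h2 : R.K u = N x := by
      rw [hx, ← mul_apply_eq_comp, Ring.mul_inverse_cancel _ hu]
      simp
    have h3 : (⟪(realPart R.B : 𝓗 →L[ℂ] 𝓗) x, x⟫_ℂ).im = 0 := by
      have hs : ContinuousLinearMap.adjoint (realPart R.B : 𝓗 →L[ℂ] 𝓗) = realPart R.B :=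
        (realPart R.B).2
      rw [← Complex.conj_eq_iff_im, inner_conj_symm]
      conv_rhs => rw [← hs, ContinuousLinearMap.adjoint_inner_left]
    have h4 := R.triplet.im_weyl_nonneg R.isClosedSymmetric hz x
    rw [← inner_conj_symm, Complex.conj_im] at h4
    rw [h2, hN, sub_apply, inner_sub_left, Complex.sub_im, h3]
    linarith
  · rw [Ring.inverse_non_unit _ hu]
    simp

lemma isPositive_imV (R : LambdaRepr H 𝓗 J Z W) {z : ℂ} (hz : 0 < z.im) :
    (R.imV z).IsPositive := by
  rw [ContinuousLinearMap.isPositive_def']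
  refine ⟨(imaginaryPart (R.V z)).2, fun u => ?_⟩
  have h1 := R.im_V_nonneg hz u
  have h2 : (R.imV z).reApplyInnerSelf u = (⟪u, R.V z u⟫_ℂ).im := by
    rw [ContinuousLinearMap.reApplyInnerSelf_apply, imV, imaginaryPart_apply_coe,
      ContinuousLinearMap.star_eq_adjoint]
    simp only [smul_apply, sub_apply, inner_smul_left,
      inner_sub_left, ContinuousLinearMap.adjoint_inner_left, ← Complex.coe_smul]
    have h3 : (⟪R.V z u, u⟫_ℂ).im = -(⟪u, R.V z u⟫_ℂ).im := by
      rw [← inner_conj_symm, Complex.conj_im]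
    simp [h3]
    ring
  rw [h2]
  exact h1

end LambdaRepr

end Classes

/-! ### The rigging `E₊ ⊆ E ⊆ E₋` generated by a positive operator -/

section Rigging

variable {E : Type u} [NormedAddCommGroup E] [InnerProductSpace ℂ E]

/-- The space `E` with the (semi)norm `‖f‖₋ = (G f, f)^{1/2}`. -/
def NegPre (G : E →L[ℂ] E) (_ : G.IsPositive) : Type u := E

variable (G : E →L[ℂ] E) (hG : G.IsPositive)

/-- The form `(G f, f)`. -/
abbrev negCore : PreInnerProductSpace.Core ℂ E where
  inner f g := ⟪G f, g⟫_ℂ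
  conj_inner_symm f g := by
    rw [inner_conj_symm]
    exact (hG.isSymmetric _ _).symm
  re_inner_nonneg f := hG.re_inner_nonneg_left _
  add_left f g h := by rw [map_add, inner_add_left]
  smul_left f g c := by rw [map_smul, inner_smul_left]

instance : SeminormedAddCommGroup (NegPre G hG) :=
  @InnerProductSpace.Core.toSeminormedAddCommGroup ℂ E _ _ _ (negCore G hG)

instance : InnerProductSpace ℂ (NegPre G hG) :=
  @InnerProductSpace.ofCore ℂ E _ _ _ (negCore G hG)

/-- The identity map of `E`, from `E` to `E` with the norm `‖·‖₋`. -/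
def toNegPre : E ≃ₗ[ℂ] NegPre G hG where
  toFun f := f
  invFun f := f
  map_add' _ _ := rfl
  map_smul' _ _ := rfl
  left_inv _ := rfl
  right_inv _ := rfl

lemma norm_toNegPre_sq (f : E) : ‖toNegPre G hG f‖ ^ 2 = (⟪G f, f⟫_ℂ).re := by
  rw [← inner_self_eq_norm_sq (𝕜 := ℂ)]
  rfl

/-- The Hilbert space `E₋`: the completion of `E` in the norm `‖·‖₋`. -/
abbrev NegSpace : Type u := UniformSpace.Completion (NegPre G hG)

/-- The canonical map from `E` to `E₋`. -/
def toNeg (f : E) : NegSpace G hG := ((toNegPre G hG f : NegPre G hG) : NegSpace G hG)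

/-- The vectors `v` of `E` for which `(u, v)` is bounded in `u` in the norm `‖·‖₋`. -/
def posSubmodule : Submodule ℂ E where
  carrier := {v | ∃ C : ℝ, ∀ u : E, ‖⟪v, u⟫_ℂ‖ ≤ C * ‖toNegPre G hG u‖}
  zero_mem' := ⟨0, by simp⟩
  add_mem' := by
    rintro v w ⟨C, hC⟩ ⟨D, hD⟩
    refine ⟨C + D, fun u => ?_⟩
    rw [inner_add_left, add_mul]
    exact (norm_add_le _ _).trans (add_le_add (hC u) (hD u))
  smul_mem' := by
    rintro c v ⟨C, hC⟩
    refine ⟨‖c‖ * C, fun u => ?_⟩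
    rw [inner_smul_left, norm_mul, RCLike.norm_conj, mul_assoc]
    exact mul_le_mul_of_nonneg_left (hC u) (norm_nonneg c)

/-- The space `E₊`, the dual of `E₋` with respect to the inner product of `E`; its norm, defined
below, is `‖v‖₊ = sup |(u, v)| / ‖u‖₋`. -/
def PosSpace : Type u := posSubmodule G hG

instance : AddCommGroup (PosSpace G hG) := inferInstanceAs (AddCommGroup (posSubmodule G hG))

instance : Module ℂ (PosSpace G hG) := inferInstanceAs (Module ℂ (posSubmodule G hG))

/-- The inclusion of `E₊` in `E`. -/
def PosSpace.val : PosSpace G hG →ₗ[ℂ] E := (posSubmodule G hG).subtype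

/-- The functional `u ↦ (u, v)` on `E` with the norm `‖·‖₋`. -/
def PosSpace.functional : PosSpace G hG →+ StrongDual ℂ (NegPre G hG) where
  toFun v := LinearMap.mkContinuousOfExistsBound
    ((innerₛₗ ℂ (PosSpace.val G hG v)).comp (toNegPre G hG).symm.toLinearMap)
    (by
      obtain ⟨C, hC⟩ := v.2
      exact ⟨C, fun u => hC ((toNegPre G hG).symm u)⟩)
  map_zero' := by ext u; simp
  map_add' v w := by ext u; simp

lemma PosSpace.functional_apply (v : PosSpace G hG) (u : E) :
    PosSpace.functional G hG v (toNegPre G hG u) = ⟪PosSpace.val G hG v, u⟫_ℂ := rfl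

lemma PosSpace.eq_zero_of_norm_functional (v : PosSpace G hG)
    (h : ‖PosSpace.functional G hG v‖ = 0) : v = 0 := by
  refine Subtype.ext (ext_inner_right ℂ fun u => ?_)
  have h1 := (PosSpace.functional G hG v).le_opNorm (toNegPre G hG u)
  rw [h, zero_mul, norm_le_zero_iff, PosSpace.functional_apply] at h1
  exact h1.trans (inner_zero_left u).symm

/-- The norm of `E₊`. -/
instance : NormedAddCommGroup (PosSpace G hG) :=
  letI : SeminormedAddCommGroup (PosSpace G hG) :=
    SeminormedAddCommGroup.induced _ _ (PosSpace.functional G hG)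
  NormedAddCommGroup.ofSeparation fun v h => PosSpace.eq_zero_of_norm_functional G hG v h

instance : NormedSpace ℂ (PosSpace G hG) where
  norm_smul_le c v := by
    have h : PosSpace.functional G hG (c • v) = conj c • PosSpace.functional G hG v := by
      ext u
      change ⟪c • PosSpace.val G hG v, (toNegPre G hG).symm u⟫_ℂ = _ * _
      rw [inner_smul_left]
      rfl
    change ‖PosSpace.functional G hG (c • v)‖ ≤ ‖c‖ * ‖PosSpace.functional G hG v‖
    rw [h, norm_smul, RCLike.norm_conj]

end Rigging

end DM

end

namespace DM

/-! ### Factorization of operators and forms -/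

lemma le_of_sq_le_mul {a b : ℝ} (hb : 0 ≤ b) (h : a ^ 2 ≤ a * b) : a ≤ b := by
  by_contra! h'
  nlinarith

lemma norm_inner_self_eq_sq {E : Type*} [SeminormedAddCommGroup E] [InnerProductSpace ℂ E] (x : E) :
    ‖⟪x, x⟫_ℂ‖ = ‖x‖ ^ 2 := by
  rw [inner_self_eq_norm_sq_to_K]; simp

section Factorization

variable {E F : Type*} [NormedAddCommGroup E] [InnerProductSpace ℂ E]
  [NormedAddCommGroup F] [InnerProductSpace ℂ F]

/-- An operator that is dominated by an operator with dense range factors through it. -/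
lemma exists_comp_eq_of_norm_le {G : Type*} [NormedAddCommGroup G] [NormedSpace ℂ G]
    [CompleteSpace G] {K : E →L[ℂ] F} (hK : DenseRange K) (Y : E →L[ℂ] G) {C : ℝ}
    (h : ∀ f, ‖Y f‖ ≤ C * ‖K f‖) : ∃ L : F →L[ℂ] G, ∀ f, L (K f) = Y f :=
  ⟨(Y : E →ₗ[ℂ] G).extendOfNorm (K : E →ₗ[ℂ] F),
    fun f => LinearMap.extendOfNorm_eq (f := (Y : E →ₗ[ℂ] G)) (e := (K : E →ₗ[ℂ] F)) hK ⟨C, h⟩ f⟩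

variable [CompleteSpace E] [CompleteSpace F]

lemma denseRange_of_ker_adjoint_eq_bot {K : E →L[ℂ] F} (hK : K.adjoint.ker = ⊥) :
    DenseRange K := by
  have h : (K.range)ᗮ = ⊥ := by rw [K.orthogonal_range, hK]
  have h1 := Submodule.topologicalClosure_eq_top_iff.2 h
  rw [← Submodule.dense_iff_topologicalClosure_eq_top] at h1
  exact h1

/-- A form that is bounded with respect to the seminorm `‖K ·‖` is induced by an operator. -/
lemma exists_eq_adjoint_comp_comp {K : E →L[ℂ] F} (hK : DenseRange K) (Y : E →L[ℂ] E) {C : ℝ}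
    (hC : 0 ≤ C) (h : ∀ u f, ‖⟪u, Y f⟫_ℂ‖ ≤ C * ‖K u‖ * ‖K f‖) :
    ∃ T : F →L[ℂ] F, Y = K.adjoint ∘L T ∘L K := by
  have h1 : ∀ f, ‖Y f‖ ≤ (C * ‖K‖) * ‖K f‖ := by
    intro f
    refine le_of_sq_le_mul (by positivity) ?_
    calc ‖Y f‖ ^ 2 = ‖⟪Y f, Y f⟫_ℂ‖ := by rw [norm_inner_self_eq_sq]
      _ ≤ C * ‖K (Y f)‖ * ‖K f‖ := h _ _
      _ ≤ C * (‖K‖ * ‖Y f‖) * ‖K f‖ := by gcongr; exact K.le_opNorm _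
      _ = _ := by ring
  obtain ⟨L, hL⟩ := exists_comp_eq_of_norm_le hK Y h1
  have h2 : ∀ u, ‖L.adjoint u‖ ≤ C * ‖K u‖ := by
    intro u
    have h3 : ∀ k, ‖⟪u, L k⟫_ℂ‖ ≤ C * ‖K u‖ * ‖k‖ := fun k => by
      refine hK.induction_on (p := fun k => ‖⟪u, L k⟫_ℂ‖ ≤ C * ‖K u‖ * ‖k‖) k
        (isClosed_le (by fun_prop) (by fun_prop)) fun f => ?_
      rw [hL]
      exact h u f
    refine le_of_sq_le_mul (by positivity) ?_
    have h4 := h3 (L.adjoint u)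
    rw [← ContinuousLinearMap.adjoint_inner_left, norm_inner_self_eq_sq] at h4
    linarith
  obtain ⟨T, hT⟩ := exists_comp_eq_of_norm_le hK L.adjoint h2
  refine ⟨T.adjoint, ?_⟩
  ext f
  refine ext_inner_left ℂ fun u => ?_
  simp only [ContinuousLinearMap.comp_apply, ContinuousLinearMap.adjoint_inner_right, hT]
  rw [ContinuousLinearMap.adjoint_inner_left, hL]

/-- Two operators `T` with the same `K* T K` coincide if `K` has dense range. -/
lemma eq_of_adjoint_comp_comp_eq {K : E →L[ℂ] F} (hK : DenseRange K) {S T : F →L[ℂ] F}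
    (h : K.adjoint ∘L S ∘L K = K.adjoint ∘L T ∘L K) : S = T := by
  have h1 : ∀ u f, ⟪K u, S (K f)⟫_ℂ = ⟪K u, T (K f)⟫_ℂ := fun u f => by
    have := congrArg (fun Y : E →L[ℂ] E => ⟪u, Y f⟫_ℂ) h
    simpa only [ContinuousLinearMap.comp_apply, ContinuousLinearMap.adjoint_inner_right] using this
  ext k
  refine hK.induction_on (p := fun k => S k = T k) k
    (isClosed_eq (by fun_prop) (by fun_prop)) fun f => ?_
  refine ext_inner_left ℂ fun l => ?_
  exact hK.induction_on (p := fun l => ⟪l, S (K f)⟫_ℂ = ⟪l, T (K f)⟫_ℂ) l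
    (isClosed_eq (by fun_prop) (by fun_prop)) fun u => h1 u f

end Factorization

/-! ### The characteristic function of a colligation at a point -/

section ImCoercive

variable {F : Type*} [NormedAddCommGroup F] [InnerProductSpace ℂ F] {M : F →L[ℂ] F}

/-- An operator `M` such that `(M x, x)` has imaginary part of the size of `‖x‖²`. -/
def IsImCoercive (M : F →L[ℂ] F) : Prop :=
  ∃ c > 0, ∀ x, c * ‖x‖ ^ 2 ≤ |(⟪x, M x⟫_ℂ).im|

lemma IsImCoercive.exists_norm_sq_le (hM : IsImCoercive M) (D : F →L[ℂ] F) :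
    ∃ C, 0 ≤ C ∧ ∀ x, ‖D x‖ ^ 2 ≤ C * |(⟪x, M x⟫_ℂ).im| := by
  obtain ⟨c, hc, h⟩ := hM
  refine ⟨‖D‖ ^ 2 / c, by positivity, fun x => ?_⟩
  calc ‖D x‖ ^ 2 ≤ (‖D‖ * ‖x‖) ^ 2 := by gcongr; exact D.le_opNorm x
    _ = ‖D‖ ^ 2 / c * (c * ‖x‖ ^ 2) := by field_simp
    _ ≤ _ := by gcongr; exact h x

lemma inverse_apply_apply {D : F →L[ℂ] F} (hD : IsUnit D) (x : F) : Ring.inverse D (D x) = x := by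
  have := congrArg (fun T : F →L[ℂ] F => T x) (Ring.inverse_mul_cancel _ hD)
  simpa using this

lemma apply_inverse_apply {D : F →L[ℂ] F} (hD : IsUnit D) (x : F) : D (Ring.inverse D x) = x := by
  have := congrArg (fun T : F →L[ℂ] F => T x) (Ring.mul_inverse_cancel _ hD)
  simpa using this

lemma exists_abs_im_inner_le (M : F →L[ℂ] F) {D : F →L[ℂ] F} (hD : IsUnit D) :
    ∃ C, 0 ≤ C ∧ ∀ x, |(⟪x, M x⟫_ℂ).im| ≤ C * ‖D x‖ ^ 2 := by
  refine ⟨‖M‖ * ‖Ring.inverse D‖ ^ 2, by positivity, fun x => ?_⟩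
  calc |(⟪x, M x⟫_ℂ).im| ≤ ‖⟪x, M x⟫_ℂ‖ := Complex.abs_im_le_norm _
    _ ≤ ‖x‖ * (‖M‖ * ‖x‖) := (norm_inner_le_norm _ _).trans (by gcongr; exact M.le_opNorm x)
    _ = ‖M‖ * ‖x‖ ^ 2 := by ring
    _ ≤ ‖M‖ * (‖Ring.inverse D‖ * ‖D x‖) ^ 2 := by
        gcongr
        conv_lhs => rw [← inverse_apply_apply hD x]
        exact (Ring.inverse D).le_opNorm _
    _ = _ := by ring

end ImCoercive

section Colligation

variable {E F : Type*} [NormedAddCommGroup E] [InnerProductSpace ℂ E] [CompleteSpace E]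
  [NormedAddCommGroup F] [InnerProductSpace ℂ F] [CompleteSpace F]

lemma inner_sub_star_of_imaginaryPart_eq {B b : F →L[ℂ] F}
    (hB : (imaginaryPart B : F →L[ℂ] F) = b) (x y : F) :
    2 * Complex.I * ⟪x, b y⟫_ℂ = ⟪x, B y⟫_ℂ - ⟪x, star B y⟫_ℂ := by
  rw [← hB, imaginaryPart_apply_coe, ← inner_sub_right, ← sub_apply]
  simp only [smul_apply, inner_smul_right, ← Complex.coe_smul, ← mul_assoc]
  simp [mul_assoc]

lemma IsSignature.apply_apply {J : E →L[ℂ] E} (hJ : IsSignature J) (u : E) : J (J u) = u := by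
  have := congrArg (fun T : E →L[ℂ] E => T u) hJ.2
  simpa using this

lemma IsSignature.inner_apply {J : E →L[ℂ] E} (hJ : IsSignature J) (u v : E) :
    ⟪u, J v⟫_ℂ = ⟪J u, v⟫_ℂ := by
  conv_lhs => rw [← hJ.1, ContinuousLinearMap.star_eq_adjoint,
    ContinuousLinearMap.adjoint_inner_right]

variable {J : E →L[ℂ] E} {K : E →L[ℂ] F} {B M : F →L[ℂ] F} {W : E →L[ℂ] E}

lemma inner_J_sub_inner_J (hJ : IsSignature J)
    (hB : (imaginaryPart B : F →L[ℂ] F) = K ∘L J ∘L K.adjoint) {v : E} {x : F}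
    (hx : (star B - M) x = K (J v)) :
    ⟪v, J v⟫_ℂ - ⟪v + (2 * Complex.I) • K.adjoint x, J (v + (2 * Complex.I) • K.adjoint x)⟫_ℂ
      = 4 * (⟪x, M x⟫_ℂ).im := by
  have h0 := inner_sub_star_of_imaginaryPart_eq hB x x
  have h1 : ⟪K.adjoint x, J v⟫_ℂ = ⟪x, star B x⟫_ℂ - ⟪x, M x⟫_ℂ := by
    rw [ContinuousLinearMap.adjoint_inner_left, ← hx, sub_apply, inner_sub_right]
  have h2 : ⟪v, J (K.adjoint x)⟫_ℂ = ⟪x, B x⟫_ℂ - conj ⟪x, M x⟫_ℂ := by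
    rw [hJ.inner_apply, ← inner_conj_symm, h1, map_sub, ContinuousLinearMap.star_eq_adjoint,
      ContinuousLinearMap.adjoint_inner_right, inner_conj_symm]
  have h3 : ⟪K.adjoint x, J (K.adjoint x)⟫_ℂ = ⟪x, (K ∘L J ∘L K.adjoint) x⟫_ℂ := by
    rw [ContinuousLinearMap.adjoint_inner_left]; rfl
  have h4 := Complex.sub_conj ⟪x, M x⟫_ℂ
  simp only [map_add, map_smul, inner_add_left, inner_add_right, inner_smul_left,
    inner_smul_right, h1, h2, h3, map_mul, Complex.conj_I, Complex.conj_ofNat]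
  push_cast at h4
  linear_combination (-(2 * Complex.I)) * h4 + (2 * Complex.I) * h0
    - 4 * ((⟪x, M x⟫_ℂ).im : ℂ) * Complex.I_sq

lemma inner_J_sub_inner_J_star (hJ : IsSignature J)
    (hB : (imaginaryPart B : F →L[ℂ] F) = K ∘L J ∘L K.adjoint) {v : E} {x : F}
    (hx : (B - star M) x = K v) :
    ⟪v, J v⟫_ℂ -
        ⟪v - (2 * Complex.I) • J (K.adjoint x), J (v - (2 * Complex.I) • J (K.adjoint x))⟫_ℂ
      = 4 * (⟪x, M x⟫_ℂ).im := by
  have h0 := inner_sub_star_of_imaginaryPart_eq hB x x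
  have hJJ : ∀ u, J (J u) = u := hJ.apply_apply
  have h1 : ⟪K.adjoint x, v⟫_ℂ = ⟪x, B x⟫_ℂ - conj ⟪x, M x⟫_ℂ := by
    rw [ContinuousLinearMap.adjoint_inner_left, ← hx, sub_apply, inner_sub_right,
      ContinuousLinearMap.star_eq_adjoint, ContinuousLinearMap.adjoint_inner_right, inner_conj_symm]
  have h2 : ⟪v, K.adjoint x⟫_ℂ = ⟪x, star B x⟫_ℂ - ⟪x, M x⟫_ℂ := by
    rw [← inner_conj_symm, h1, map_sub, ContinuousLinearMap.star_eq_adjoint,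
      ContinuousLinearMap.adjoint_inner_right, inner_conj_symm, Complex.conj_conj]
  have h3 : ⟪J (K.adjoint x), K.adjoint x⟫_ℂ = ⟪x, (K ∘L J ∘L K.adjoint) x⟫_ℂ := by
    rw [← hJ.inner_apply, ContinuousLinearMap.adjoint_inner_left]; rfl
  have h3' : ⟪J (K.adjoint x), J v⟫_ℂ = ⟪K.adjoint x, v⟫_ℂ := by
    rw [← hJ.inner_apply, hJJ]
  have h4 := Complex.sub_conj ⟪x, M x⟫_ℂ
  simp only [map_sub, map_smul, inner_sub_left, inner_sub_right, inner_smul_left,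
    inner_smul_right, hJJ, h3', h1, h2, h3, map_mul, Complex.conj_I, Complex.conj_ofNat]
  push_cast at h4
  linear_combination (-(2 * Complex.I)) * h4 + (2 * Complex.I) * h0
    - 4 * ((⟪x, M x⟫_ℂ).im : ℂ) * Complex.I_sq

/-- The value `1 + 2i K* (B* - M)⁻¹ K J`. -/
noncomputable abbrev charValue (J : E →L[ℂ] E) (K : E →L[ℂ] F) (B M : F →L[ℂ] F) : E →L[ℂ] E :=
  1 + (2 * Complex.I) • (K.adjoint ∘L Ring.inverse (star B - M) ∘L K ∘L J)

/-- The form `(J v, v) - (J W v, W v)`. -/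
noncomputable abbrev defectForm (J W : E →L[ℂ] E) (v : E) : ℂ :=
  ⟪v, J v⟫_ℂ - ⟪W v, J (W v)⟫_ℂ

lemma defectForm_charValue (hJ : IsSignature J)
    (hB : (imaginaryPart B : F →L[ℂ] F) = K ∘L J ∘L K.adjoint) (hD : IsUnit (star B - M))
    (v : E) : ∃ x, (star B - M) x = K (J v) ∧
      ‖defectForm J (charValue J K B M) v‖ = 4 * |(⟪x, M x⟫_ℂ).im| := by
  refine ⟨_, apply_inverse_apply hD _, ?_⟩
  have h := inner_J_sub_inner_J hJ hB (apply_inverse_apply hD (K (J v)))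
  have h1 : charValue J K B M v =
    v + (2 * Complex.I) • K.adjoint (Ring.inverse (star B - M) (K (J v))) := by
    simp [charValue]
  rw [defectForm, h1, h]
  simp

lemma star_charValue (hJ : IsSignature J) (v : E) : star (charValue J K B M) v =
    v - (2 * Complex.I) • J (K.adjoint (Ring.inverse (B - star M) (K v))) := by
  have h : star (Ring.inverse (star B - M)) = Ring.inverse (B - star M) := by
    rw [← Ring.inverse_star, star_sub, star_star]
  have hJ' := hJ.1
  simp only [ContinuousLinearMap.star_eq_adjoint] at h hJ'
  rw [charValue, star_add, star_smul, star_one]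
  simp only [ContinuousLinearMap.star_eq_adjoint, ContinuousLinearMap.adjoint_comp, h, hJ',
    ContinuousLinearMap.adjoint_adjoint]
  simp [sub_eq_add_neg]

lemma defectForm_star_charValue (hJ : IsSignature J)
    (hB : (imaginaryPart B : F →L[ℂ] F) = K ∘L J ∘L K.adjoint) (hD : IsUnit (star B - M))
    (v : E) : ∃ x, (B - star M) x = K v ∧
      ‖defectForm J (star (charValue J K B M)) v‖ = 4 * |(⟪x, M x⟫_ℂ).im| := by
  have hD' : IsUnit (B - star M) := by simpa using hD.star
  refine ⟨_, apply_inverse_apply hD' _, ?_⟩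
  have h := inner_J_sub_inner_J_star hJ hB (apply_inverse_apply hD' (K v))
  rw [defectForm, star_charValue hJ, h]
  simp

lemma IsJUnitary.defectForm_mul {X : E →L[ℂ] E} (hX : IsJUnitary J X) (W : E →L[ℂ] E) (v : E) :
    defectForm J (W * X) v = defectForm J W (X v) := by
  have h : ⟪v, J v⟫_ℂ = ⟪X v, J (X v)⟫_ℂ := by
    conv_lhs => rw [← hX.1]
    simp [ContinuousLinearMap.star_eq_adjoint, ContinuousLinearMap.adjoint_inner_right]
  simp [defectForm, h]

lemma IsJUnitary.defectForm_star_mul {X : E →L[ℂ] E} (hX : IsJUnitary J X) (W : E →L[ℂ] E)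
    (v : E) : defectForm J (star (W * X)) v = defectForm J (star W) v := by
  have h : ∀ u, ⟪star X u, J (star X u)⟫_ℂ = ⟪u, J u⟫_ℂ := fun u => by
    conv_rhs => rw [← hX.2]
    simp [ContinuousLinearMap.star_eq_adjoint, ContinuousLinearMap.adjoint_inner_left]
  rw [defectForm, star_mul, mul_apply_eq_comp, h]

/-- If two characteristic functions at a point differ by a `J`-unitary right factor `X`, then
`(X - 1) J` is bounded with respect to the seminorm `‖K ·‖`. -/
theorem exists_norm_inner_sub_one_mul_le {F₁ : Type*} [NormedAddCommGroup F₁]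
    [InnerProductSpace ℂ F₁] [CompleteSpace F₁] {K₁ : E →L[ℂ] F₁} {B₁ M₁ : F₁ →L[ℂ] F₁}
    {X : E →L[ℂ] E} (hJ : IsSignature J) (hX : IsJUnitary J X)
    (hB : (imaginaryPart B : F →L[ℂ] F) = K ∘L J ∘L K.adjoint)
    (hB₁ : (imaginaryPart B₁ : F₁ →L[ℂ] F₁) = K₁ ∘L J ∘L K₁.adjoint)
    (hD : IsUnit (star B - M)) (hD₁ : IsUnit (star B₁ - M₁))
    (hM : IsImCoercive M) (hM₁ : IsImCoercive M₁)
    (hW : charValue J K₁ B₁ M₁ = charValue J K B M * X) :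
    ∃ C, 0 ≤ C ∧ ∀ u f, ‖⟪u, ((X - 1) * J) f⟫_ℂ‖ ≤ C * ‖K u‖ * ‖K f‖ := by
  obtain ⟨a, ha, h1⟩ : ∃ a, 0 ≤ a ∧ ∀ u, ‖K₁ u‖ ≤ a * ‖K u‖ := by
    obtain ⟨C, hC, h⟩ := hM₁.exists_norm_sq_le (B₁ - star M₁)
    obtain ⟨C', hC', h'⟩ := exists_abs_im_inner_le M (D := B - star M) (by simpa using hD.star)
    refine ⟨√(C * C'), by positivity, fun u => abs_le_of_sq_le_sq' ?_ (by positivity) |>.2⟩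
    obtain ⟨x, hx, hx'⟩ := defectForm_star_charValue hJ hB₁ hD₁ u
    obtain ⟨y, hy, hy'⟩ := defectForm_star_charValue hJ hB hD u
    rw [hW, hX.defectForm_star_mul, hy'] at hx'
    rw [mul_pow, Real.sq_sqrt (by positivity), mul_assoc, ← hx, ← hy]
    refine (h x).trans ?_
    gcongr
    rw [show |(⟪x, M₁ x⟫_ℂ).im| = |(⟪y, M y⟫_ℂ).im| by linarith]
    exact h' y
  obtain ⟨b, hb, h2⟩ : ∃ b, 0 ≤ b ∧ ∀ u, ‖K (J (X u))‖ ≤ b * ‖K₁ (J u)‖ := by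
    obtain ⟨C, hC, h⟩ := hM.exists_norm_sq_le (star B - M)
    obtain ⟨C', hC', h'⟩ := exists_abs_im_inner_le M₁ hD₁
    refine ⟨√(C * C'), by positivity, fun u => abs_le_of_sq_le_sq' ?_ (by positivity) |>.2⟩
    obtain ⟨x, hx, hx'⟩ := defectForm_charValue hJ hB₁ hD₁ u
    obtain ⟨y, hy, hy'⟩ := defectForm_charValue hJ hB hD (X u)
    rw [hW, hX.defectForm_mul, hy'] at hx'
    rw [mul_pow, Real.sq_sqrt (by positivity), mul_assoc, ← hx, ← hy]
    refine (h y).trans ?_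
    gcongr
    rw [show |(⟪y, M y⟫_ℂ).im| = |(⟪x, M₁ x⟫_ℂ).im| by linarith]
    exact h' x
  set Q := Ring.inverse (star B - M)
  set Q₁ := Ring.inverse (star B₁ - M₁)
  refine ⟨2 * (‖Q₁‖ * a * a + ‖Q‖ * b * a), by positivity, fun u f => ?_⟩
  have h3 : ((X - 1) * J) f = (2 * Complex.I) • K₁.adjoint (Q₁ (K₁ f))
      - (2 * Complex.I) • K.adjoint (Q (K (J (X (J f))))) := by
    have := congrArg (fun T : E →L[ℂ] E => T (J f)) hW
    simp [charValue, hJ.apply_apply] at this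
    simp only [mul_apply_eq_comp, sub_apply, one_apply_eq_self]
    linear_combination (norm := module) -this
  have h4 : ‖⟪K₁ u, Q₁ (K₁ f)⟫_ℂ‖ ≤ (a * ‖K u‖) * (‖Q₁‖ * (a * ‖K f‖)) := by
    refine (norm_inner_le_norm _ _).trans ?_
    gcongr
    · exact h1 u
    · exact (Q₁.le_opNorm _).trans (by gcongr; exact h1 f)
  have h5 : ‖⟪K u, Q (K (J (X (J f))))⟫_ℂ‖ ≤ ‖K u‖ * (‖Q‖ * (b * (a * ‖K f‖))) := by
    refine (norm_inner_le_norm _ _).trans ?_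
    gcongr
    refine (Q.le_opNorm _).trans ?_
    gcongr
    refine (h2 _).trans ?_
    rw [hJ.apply_apply]
    gcongr
    exact h1 f
  rw [h3, inner_sub_right, inner_smul_right, inner_smul_right,
    ContinuousLinearMap.adjoint_inner_right, ContinuousLinearMap.adjoint_inner_right, ← mul_sub,
    norm_mul]
  calc ‖2 * Complex.I‖ * ‖⟪K₁ u, Q₁ (K₁ f)⟫_ℂ - ⟪K u, Q (K (J (X (J f))))⟫_ℂ‖
      ≤ 2 * ((a * ‖K u‖) * (‖Q₁‖ * (a * ‖K f‖)) + ‖K u‖ * (‖Q‖ * (b * (a * ‖K f‖)))) := by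
        rw [norm_mul, Complex.norm_I, mul_one, Complex.norm_ofNat]
        gcongr
        exact (norm_sub_le _ _).trans (add_le_add h4 h5)
    _ = _ := by ring

end Colligation

section Triplet

variable {H : Type v} [NormedAddCommGroup H] [InnerProductSpace ℂ H] [CompleteSpace H]
  {A : H →ₗ.[ℂ] H} {𝓗 : Type w} [NormedAddCommGroup 𝓗] [InnerProductSpace ℂ 𝓗]

lemma mem_resolventSet_domRestrict {L : A†.domain →ₗ[ℂ] 𝓗} {z : ℂ} :
    z ∈ resolventSet (A†.domRestrict ((LinearMap.ker L).map A†.domain.subtype)) ↔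
      ∃ R : H →L[ℂ] H,
        (∀ y : H, ∃ f : A†.domain, L f = 0 ∧ (f : H) = R y ∧ A† f - z • (f : H) = y) ∧
        ∀ f : A†.domain, L f = 0 → R (A† f - z • (f : H)) = f := by
  have key : ∀ f : A†.domain, L f = 0 → ∃ x : (A†.domRestrict
      ((LinearMap.ker L).map A†.domain.subtype)).domain, (x : H) = f ∧
      A†.domRestrict ((LinearMap.ker L).map A†.domain.subtype) x = A† f := fun f hf =>
    ⟨⟨f, ⟨⟨f, hf, rfl⟩, f.2⟩⟩, rfl, LinearPMap.domRestrict_apply rfl⟩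
  have key' : ∀ x : (A†.domRestrict ((LinearMap.ker L).map A†.domain.subtype)).domain,
      ∃ f : A†.domain, L f = 0 ∧ (x : H) = f ∧
      A†.domRestrict ((LinearMap.ker L).map A†.domain.subtype) x = A† f := by
    rintro ⟨x, ⟨f, hf, rfl⟩, hx⟩
    exact ⟨f, hf, rfl, LinearPMap.domRestrict_apply rfl⟩
  refine exists_congr fun R => and_congr (forall_congr' fun y => ?_) ?_
  · constructor
    · rintro ⟨x, hx, hx'⟩
      obtain ⟨f, hf, hf1, hf2⟩ := key' x
      exact ⟨f, hf, by rw [← hf1, hx], by rw [← hf1, ← hf2, hx']⟩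
    · rintro ⟨f, hf, hf1, hf2⟩
      obtain ⟨x, hx1, hx2⟩ := key f hf
      exact ⟨x, by rw [hx1, hf1], by rw [hx1, hx2, hf2]⟩
  · constructor
    · intro h f hf
      obtain ⟨x, hx1, hx2⟩ := key f hf
      rw [← hx1, ← hx2, h]
    · intro h x
      obtain ⟨f, hf, hf1, hf2⟩ := key' x
      rw [hf1, hf2, h f hf]

lemma exists_mem_defect_of_mem_resolventSet {L : A†.domain →ₗ[ℂ] 𝓗}
    (hL : Function.Surjective L) {z : ℂ}
    (hz : z ∈ resolventSet (A†.domRestrict ((LinearMap.ker L).map A†.domain.subtype))) (h : 𝓗) :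
    ∃ f : A†.domain, L f = h ∧ A† f = z • (f : H) := by
  obtain ⟨R, hR, -⟩ := mem_resolventSet_domRestrict.1 hz
  obtain ⟨f, hf⟩ := hL h
  obtain ⟨g, hg0, -, hg⟩ := hR (A† f - z • (f : H))
  refine ⟨f - g, by rw [map_sub, hg0, hf, sub_zero], ?_⟩
  rw [LinearPMap.map_sub, Submodule.coe_sub, smul_sub]
  linear_combination (norm := module) -hg

lemma eq_zero_of_mem_resolventSet {L : A†.domain →ₗ[ℂ] 𝓗} {z : ℂ}
    (hz : z ∈ resolventSet (A†.domRestrict ((LinearMap.ker L).map A†.domain.subtype)))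
    {f : A†.domain} (hf : L f = 0) (hf' : A† f = z • (f : H)) : f = 0 := by
  obtain ⟨R, -, hR⟩ := mem_resolventSet_domRestrict.1 hz
  have := hR f hf
  rw [hf', sub_self, map_zero] at this
  exact Subtype.ext this.symm

/-- Defect vectors with a given boundary value depend continuously on the spectral parameter. -/
lemma exists_norm_sub_le_of_mem_resolventSet {L : A†.domain →ₗ[ℂ] 𝓗} {z : ℂ}
    (hz : z ∈ resolventSet (A†.domRestrict ((LinearMap.ker L).map A†.domain.subtype)))
    {f : A†.domain} (hf : A† f = z • (f : H)) :
    ∃ C, 0 ≤ C ∧ ∀ (w : ℂ) (g : A†.domain), ‖w - z‖ * C ≤ 1 / 2 → L g = L f →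
      A† g = w • (g : H) → ‖(g : H) - f‖ ≤ 2 * (‖w - z‖ * C) * ‖(f : H)‖ := by
  obtain ⟨R, -, hR⟩ := mem_resolventSet_domRestrict.1 hz
  refine ⟨‖R‖, norm_nonneg _, fun w g hw hgf hg => ?_⟩
  have h1 := hR (g - f) (by rw [map_sub, hgf, sub_self])
  have h2 : A† (g - f) - z • ((g - f : A†.domain) : H) = (w - z) • (g : H) := by
    rw [LinearPMap.map_sub, Submodule.coe_sub, hg, hf]
    module
  rw [h2, Submodule.coe_sub] at h1
  have h3 : ‖(g : H) - f‖ ≤ ‖R‖ * (‖w - z‖ * ‖(g : H)‖) := by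
    rw [← h1, ← norm_smul]
    exact R.le_opNorm _
  have h4 : ‖(g : H)‖ ≤ ‖(g : H) - f‖ + ‖(f : H)‖ := norm_le_norm_sub_add _ _
  have h5 : ‖R‖ * (‖w - z‖ * ‖(g : H)‖) ≤
      (‖w - z‖ * ‖R‖) * (‖(g : H) - f‖ + ‖(f : H)‖) := by
    calc _ = (‖w - z‖ * ‖R‖) * ‖(g : H)‖ := by ring
      _ ≤ _ := by gcongr
  nlinarith [norm_nonneg ((g : H) - f)]

namespace BoundaryTriplet

variable (P : BoundaryTriplet A 𝓗)

lemma surjective_Γ₀ : Function.Surjective P.Γ₀ := fun h =>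
  let ⟨f, _, hf⟩ := P.surjective 0 h
  ⟨f, hf⟩

lemma surjective_Γ₁_sub (B : 𝓗 →L[ℂ] 𝓗) :
    Function.Surjective (P.Γ₁ - (B : 𝓗 →ₗ[ℂ] 𝓗) ∘ₗ P.Γ₀) := fun h => by
  obtain ⟨f, hf₁, hf₀⟩ := P.surjective h 0
  exact ⟨f, by simp [hf₁, hf₀]⟩

/-- `Γ₀` is bounded on every defect subspace. -/
lemma exists_norm_Γ₀_le [CompleteSpace 𝓗] (z : ℂ) :
    ∃ C, 0 ≤ C ∧ ∀ f : A†.domain, A† f = z • (f : H) → ‖P.Γ₀ f‖ ≤ C * ‖(f : H)‖ := by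
  let S := {f : A†.domain // A† f = z • (f : H) ∧ ‖(f : H)‖ ≤ 1}
  obtain ⟨C, hC⟩ := banach_steinhaus (g := fun f : S => innerSL ℂ (P.Γ₀ f.1)) (by
    intro k
    obtain ⟨g, hg₁, hg₀⟩ := P.surjective k 0
    refine ⟨‖z‖ * ‖(g : H)‖ + ‖A† g‖, fun ⟨f, hf, hf1⟩ => ?_⟩
    have h1 := P.green g f
    rw [hg₁, hg₀, hf, inner_zero_right, sub_zero] at h1
    rw [innerSL_apply_apply, ← h1]
    have h2 : ‖⟪(f : H), A† g⟫_ℂ‖ ≤ ‖A† g‖ := by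
      refine (norm_inner_le_norm _ _).trans ?_
      nlinarith [norm_nonneg (A† g)]
    have h3 : ‖⟪z • (f : H), (g : H)⟫_ℂ‖ ≤ ‖z‖ * ‖(g : H)‖ := by
      refine (norm_inner_le_norm _ _).trans ?_
      rw [norm_smul]
      gcongr
      nlinarith [norm_nonneg z]
    exact (norm_sub_le _ _).trans (by linarith))
  refine ⟨max C 0, le_max_right _ _, fun f hf => ?_⟩
  rcases eq_or_ne (f : H) 0 with h0 | h0
  · have : f = 0 := Subtype.ext h0
    simp [this]
  · have hpos : 0 < ‖(f : H)‖ := norm_pos_iff.2 h0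
    set c : ℂ := ((‖(f : H)‖⁻¹ : ℝ) : ℂ) with hc
    have hcn : ‖c‖ = ‖(f : H)‖⁻¹ := by simp [hc]
    have h1 := hC ⟨c • f, by rw [LinearPMap.map_smul, hf, Submodule.coe_smul, smul_comm], by
      rw [Submodule.coe_smul, norm_smul, hcn, inv_mul_cancel₀ hpos.ne']⟩
    rw [innerSL_apply_norm, map_smul, norm_smul, hcn, inv_mul_le_iff₀ hpos] at h1
    refine h1.trans ?_
    rw [mul_comm]
    gcongr
    exact le_max_left _ _

lemma exists_isWeylAt [CompleteSpace 𝓗] {z : ℂ}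
    (h : ∀ k, ∃ f : A†.domain, P.Γ₀ f = k ∧ A† f = z • (f : H))
    (h' : ∀ k, ∃ f : A†.domain, P.Γ₀ f = k ∧ A† f = conj z • (f : H)) :
    ∃ T, P.IsWeylAt z T := by
  choose f hf₀ hf using h
  choose g hg₀ hg using h'
  have key : ∀ p q : A†.domain, A† p = z • (p : H) → A† q = conj z • (q : H) →
      ⟪P.Γ₀ q, P.Γ₁ p⟫_ℂ = ⟪P.Γ₁ q, P.Γ₀ p⟫_ℂ := fun p q hp hq => by
    have := P.green p q
    rw [hp, hq, inner_smul_left, inner_smul_right, Complex.conj_conj, sub_self] at this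
    exact (sub_eq_zero.1 this.symm)
  have key' : ∀ k l, ⟪l, P.Γ₁ (f k)⟫_ℂ = ⟪P.Γ₁ (g l), k⟫_ℂ := fun k l => by
    have := key _ _ (hf k) (hg l)
    rwa [hf₀, hg₀] at this
  let T : 𝓗 →ₗ[ℂ] 𝓗 :=
    { toFun := fun k => P.Γ₁ (f k)
      map_add' := fun k l => ext_inner_left ℂ fun m => by
        rw [inner_add_right, key', key', key', inner_add_right]
      map_smul' := fun c k => ext_inner_left ℂ fun m => by
        rw [RingHom.id_apply, inner_smul_right, key', key', inner_smul_right] }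
  have hT : ∀ (u : ℕ → 𝓗) (x y : 𝓗), Filter.Tendsto u Filter.atTop (nhds x) →
      Filter.Tendsto (T ∘ u) Filter.atTop (nhds y) → y = T x := by
    intro u x y hu hTu
    refine ext_inner_left ℂ fun m => ?_
    have h1 : Filter.Tendsto (fun n => ⟪m, T (u n)⟫_ℂ) Filter.atTop (nhds ⟪m, y⟫_ℂ) :=
      Filter.Tendsto.inner tendsto_const_nhds hTu
    have h2 : Filter.Tendsto (fun n => ⟪P.Γ₁ (g m), u n⟫_ℂ) Filter.atTop
        (nhds ⟪P.Γ₁ (g m), x⟫_ℂ) := Filter.Tendsto.inner tendsto_const_nhds hu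
    have h3 : ⟪m, T x⟫_ℂ = ⟪P.Γ₁ (g m), x⟫_ℂ := key' x m
    rw [h3]
    exact tendsto_nhds_unique h1 (h2.congr fun n => (key' (u n) m).symm)
  refine ⟨⟨T, T.continuous_of_seq_closed_graph hT⟩, fun p hp => ext_inner_left ℂ fun m => ?_⟩
  change ⟪m, P.Γ₁ (f (P.Γ₀ p))⟫_ℂ = _
  have := key _ _ hp (hg m)
  rw [hg₀] at this
  rw [key', this]

lemma isWeylAt_weyl [CompleteSpace 𝓗] {z : ℂ}
    (h : ∀ k, ∃ f : A†.domain, P.Γ₀ f = k ∧ A† f = z • (f : H))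
    (h' : ∀ k, ∃ f : A†.domain, P.Γ₀ f = k ∧ A† f = conj z • (f : H)) :
    P.IsWeylAt z (P.weyl z) := by
  have hT := P.exists_isWeylAt h h'
  rw [weyl, dif_pos hT]
  exact hT.choose_spec

lemma isWeylAt_weyl_of_im_ne_zero [CompleteSpace 𝓗] (hA : IsClosedSymmetric A) {z : ℂ}
    (hz : z.im ≠ 0) : P.IsWeylAt z (P.weyl z) :=
  P.isWeylAt_weyl (P.exists_mem_defect hA hz) (P.exists_mem_defect hA (by simpa using hz))

lemma isWeylAt_weyl_of_mem_resolventSet [CompleteSpace 𝓗] (hA : IsClosedSymmetric A) {z : ℂ}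
    (hz : z ∈ resolventSet P.ext₀) : P.IsWeylAt z (P.weyl z) := by
  by_cases him : z.im = 0
  · have h := exists_mem_defect_of_mem_resolventSet P.surjective_Γ₀ hz
    exact P.isWeylAt_weyl h (by rwa [Complex.conj_eq_iff_im.2 him])
  · exact P.isWeylAt_weyl_of_im_ne_zero hA him

lemma mem_resolventSet_ext₀ (hA : IsClosedSymmetric A) {z : ℂ} (hz : z.im ≠ 0) :
    z ∈ resolventSet P.ext₀ := by
  refine mem_resolventSet_domRestrict.2 ?_
  have hpos : 0 < |z.im| := abs_pos.2 hz
  choose f hf₀ hf using fun y => P.exists_sub_smul_eq hA hz y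
  have huniq : ∀ g : A†.domain, P.Γ₀ g = 0 → f (A† g - z • (g : H)) = g := by
    intro g hg
    have h1 := P.eq_zero_of_mem_ker hz (f (A† g - z • (g : H)) - g)
      (by rw [map_sub, hf₀, hg, sub_zero]) (by
        have := hf (A† g - z • (g : H))
        rw [LinearPMap.map_sub, Submodule.coe_sub]
        linear_combination (norm := module) this)
    exact sub_eq_zero.1 (Subtype.ext h1)
  let R : H →ₗ[ℂ] H :=
    { toFun := fun y => f y
      map_add' := fun x y => by
        have := huniq (f x + f y) (by rw [map_add, hf₀, hf₀, add_zero])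
        rw [← Submodule.coe_add, ← this]
        congr 2
        rw [LinearPMap.map_add, Submodule.coe_add]
        linear_combination (norm := module) -hf x - hf y
      map_smul' := fun c x => by
        have := huniq (c • f x) (by rw [map_smul, hf₀, smul_zero])
        rw [RingHom.id_apply, ← Submodule.coe_smul, ← this]
        congr 2
        rw [LinearPMap.map_smul, Submodule.coe_smul]
        linear_combination (norm := module) -c • hf x }
  refine ⟨R.mkContinuous |z.im|⁻¹ fun y => ?_, fun y => ⟨f y, hf₀ y, rfl, hf y⟩, fun g hg => ?_⟩
  · have := P.norm_le_of_mem_graph₀ hA z (P.mem_graph₀ hA (hf₀ y))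
    rw [hf y] at this
    rwa [inv_mul_eq_div, le_div_iff₀ hpos, mul_comm]
  · exact congrArg Subtype.val (huniq g hg)

lemma im_inner_weyl [CompleteSpace 𝓗] (hA : IsClosedSymmetric A) {z : ℂ} (hz : z.im ≠ 0)
    {f : A†.domain} (hf : A† f = z • (f : H)) :
    (⟪P.Γ₀ f, P.weyl z (P.Γ₀ f)⟫_ℂ).im = z.im * ‖(f : H)‖ ^ 2 := by
  rw [P.isWeylAt_weyl_of_im_ne_zero hA hz f hf]
  have h1 := P.green f f
  rw [hf, inner_smul_left, inner_smul_right, ← sub_mul, Complex.sub_conj,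
    inner_self_eq_norm_sq_to_K, ← inner_conj_symm (P.Γ₁ f), Complex.sub_conj] at h1
  have h2 := congrArg Complex.im h1
  simp [← Complex.ofReal_pow] at h2
  linarith

lemma isImCoercive_weyl [CompleteSpace 𝓗] (hA : IsClosedSymmetric A) {z : ℂ} (hz : z.im ≠ 0) :
    IsImCoercive (P.weyl z) := by
  obtain ⟨C, hC, h⟩ := P.exists_norm_Γ₀_le z
  have hpos : 0 < |z.im| := abs_pos.2 hz
  refine ⟨|z.im| / (C + 1) ^ 2, by positivity, fun k => ?_⟩
  obtain ⟨f, rfl, hf⟩ := P.exists_mem_defect hA hz k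
  rw [P.im_inner_weyl hA hz hf, abs_mul, abs_of_nonneg (sq_nonneg ‖(f : H)‖), div_mul_eq_mul_div,
    div_le_iff₀ (by positivity), mul_assoc, ← mul_pow]
  gcongr
  refine (h f hf).trans ?_
  rw [mul_comm]
  gcongr
  linarith

lemma sub_weyl_apply {z : ℂ} (hz : P.IsWeylAt z (P.weyl z)) (C : 𝓗 →L[ℂ] 𝓗) {f : A†.domain}
    (hf : A† f = z • (f : H)) : (C - P.weyl z) (P.Γ₀ f) = C (P.Γ₀ f) - P.Γ₁ f := by
  rw [sub_apply, hz f hf]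

lemma isUnit_sub_weyl [CompleteSpace 𝓗] (hA : IsClosedSymmetric A) {z : ℂ}
    (hz : z ∈ resolventSet P.ext₀) {C : 𝓗 →L[ℂ] 𝓗} (hC : z ∈ resolventSet (P.ext C)) :
    IsUnit (C - P.weyl z) := by
  have hM := P.isWeylAt_weyl_of_mem_resolventSet hA hz
  rw [ContinuousLinearMap.isUnit_iff_bijective]
  constructor
  · rw [injective_iff_map_eq_zero]
    intro k hk
    obtain ⟨f, rfl, hf⟩ := exists_mem_defect_of_mem_resolventSet P.surjective_Γ₀ hz k
    rw [P.sub_weyl_apply hM C hf] at hk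
    have : f = 0 := eq_zero_of_mem_resolventSet hC (by
      rw [LinearMap.sub_apply, ← neg_sub]
      exact neg_eq_zero.2 hk) hf
    rw [this, map_zero]
  · intro k
    obtain ⟨f, hf', hf⟩ := exists_mem_defect_of_mem_resolventSet (P.surjective_Γ₁_sub C) hC (-k)
    refine ⟨P.Γ₀ f, ?_⟩
    rw [P.sub_weyl_apply hM C hf, ← neg_sub]
    exact neg_eq_iff_eq_neg.2 hf'

end BoundaryTriplet

end Triplet

section

variable {E : Type u} [NormedAddCommGroup E] [InnerProductSpace ℂ E] [CompleteSpace E]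
  {H : Type v} [NormedAddCommGroup H] [InnerProductSpace ℂ H] [CompleteSpace H]
  {𝓗 : Type w} [NormedAddCommGroup 𝓗] [InnerProductSpace ℂ 𝓗] [CompleteSpace 𝓗]
  {J : E →L[ℂ] E} {Z : Set ℂ} {W : ℂ → E →L[ℂ] E}

/-- The `J`-adjoint `J U* J`, which is the inverse of a `J`-unitary operator `U`. -/
noncomputable abbrev jAdjoint (J U : E →L[ℂ] E) : E →L[ℂ] E := J * star U * J

lemma IsJUnitary.mul_jAdjoint {U : E →L[ℂ] E} (hJ : IsSignature J) (hU : IsJUnitary J U) :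
    U * jAdjoint J U = 1 := by
  rw [jAdjoint, ← mul_assoc, ← mul_assoc, hU.2, hJ.2]

lemma IsJUnitary.jAdjoint_mul {U : E →L[ℂ] E} (hJ : IsSignature J) (hU : IsJUnitary J U) :
    jAdjoint J U * U = 1 := by
  rw [jAdjoint, mul_assoc, mul_assoc, ← mul_assoc (star U), hU.1, hJ.2]

lemma IsJUnitary.mul {U V : E →L[ℂ] E} (hU : IsJUnitary J U) (hV : IsJUnitary J V) :
    IsJUnitary J (U * V) := by
  constructor
  · rw [star_mul]
    calc _ = star V * (star U * J * U) * V := by noncomm_ring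
      _ = _ := by rw [hU.1, hV.1]
  · rw [star_mul]
    calc _ = U * (V * J * star V) * star U := by noncomm_ring
      _ = _ := by rw [hV.2, hU.2]

lemma IsJUnitary.jAdjoint {U : E →L[ℂ] E} (hJ : IsSignature J) (hU : IsJUnitary J U) :
    IsJUnitary J (jAdjoint J U) := by
  have h : star (DM.jAdjoint J U) = J * U * J := by
    rw [star_mul, star_mul, star_star, hJ.1, mul_assoc]
  rw [IsJUnitary, h]
  constructor
  · calc _ = J * U * (J * J) * J * star U * J := by noncomm_ring
      _ = J * (U * J * star U) * J := by rw [hJ.2]; noncomm_ring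
      _ = _ := by rw [hU.2, hJ.2, one_mul]
  · calc _ = J * star U * (J * J) * J * U * J := by noncomm_ring
      _ = J * (star U * J * U) * J := by rw [hJ.2]; noncomm_ring
      _ = _ := by rw [hU.1, hJ.2, one_mul]

lemma adjoint_comp_star (K : E →L[ℂ] 𝓗) (U : E →L[ℂ] E) :
    (K ∘L star U).adjoint = U ∘L K.adjoint := by
  rw [ContinuousLinearMap.adjoint_comp, ContinuousLinearMap.star_eq_adjoint,
    ContinuousLinearMap.adjoint_adjoint]

/-- The representation of `U W U⁻¹` for a `J`-unitary operator `U`. -/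
noncomputable def LambdaRepr.conj (R : LambdaRepr H 𝓗 J Z W) (hJ : IsSignature J) {U : E →L[ℂ] E}
    (hU : IsJUnitary J U) : LambdaRepr H 𝓗 J Z (fun z => U * W z * jAdjoint J U) where
  A := R.A
  isClosedSymmetric := R.isClosedSymmetric
  triplet := R.triplet
  B := R.B
  K := R.K ∘L star U
  im_B := by
    have h : ∀ v, J v = star U (J (U v)) := fun v =>
      (congrArg (fun T : E →L[ℂ] E => T v) hU.1).symm
    rw [R.im_B, adjoint_comp_star]
    ext k
    exact congrArg R.K (h (R.K.adjoint k))
  isOpen := R.isOpen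
  nonempty := R.nonempty
  subset_resolventSet := R.subset_resolventSet
  differentiableOn := (R.differentiableOn.const_mul U).mul_const _
  eq_on := fun z hz => by
    have h : (R.K ∘L J) ∘L jAdjoint J U = (R.K ∘L star U) ∘L J := by
      change (R.K ∘L J) ∘L (J * star U * J) = _
      ext v
      simp [hJ.apply_apply]
    rw [R.eq_on z hz, mul_add, add_mul, mul_one, hU.mul_jAdjoint hJ, mul_smul_comm, smul_mul_assoc,
      adjoint_comp_star, ← h]
    rfl

lemma InLambda0.conj (hJ : IsSignature J) {U : E →L[ℂ] E} (hU : IsJUnitary J U)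
    (hW : InLambda0.{u, v, w} J Z W) :
    InLambda0.{u, v, w} J Z (fun z => U * W z * jAdjoint J U) := by
  obtain ⟨H, i1, i2, i3, i4, 𝓗, i5, i6, i7, R, hR⟩ := hW
  refine ⟨H, i1, i2, i3, i4, 𝓗, i5, i6, i7, R.conj hJ hU, ?_⟩
  have h : (R.conj hJ hU).K.adjoint = U ∘L R.K.adjoint := adjoint_comp_star R.K U
  rw [LinearMap.ker_eq_bot'] at hR ⊢
  intro k hk
  apply hR
  rw [h] at hk
  have := congrArg (jAdjoint J U) hk
  rw [map_zero] at this
  rw [← this]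
  have h2 := congrArg (fun T : E →L[ℂ] E => T (R.K.adjoint k)) (hU.jAdjoint_mul hJ)
  exact h2.symm

namespace LambdaRepr

variable (R : LambdaRepr H 𝓗 J Z W)

lemma eq_charValue {z : ℂ} (hz : z ∈ Z ∩ resolventSet R.triplet.ext₀) :
    W z = charValue J R.K R.B (R.triplet.weyl z) := R.eq_on z hz

lemma isUnit_sub_weyl {z : ℂ} (hz : z ∈ Z ∩ resolventSet R.triplet.ext₀) :
    IsUnit (star R.B - R.triplet.weyl z) :=
  R.triplet.isUnit_sub_weyl R.isClosedSymmetric hz.2 (R.subset_resolventSet hz.1)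

lemma exists_im_ne_zero (R : LambdaRepr H 𝓗 J Z W) : ∃ z ∈ Z, z.im ≠ 0 := by
  obtain ⟨z, hz⟩ := R.nonempty
  by_contra! h
  have h1 : Filter.Tendsto (fun t : ℝ => z + t * Complex.I) (nhdsWithin 0 {0}ᶜ) (nhds z) := by
    have : Continuous fun t : ℝ => z + t * Complex.I := by fun_prop
    simpa using (this.tendsto 0).mono_left nhdsWithin_le_nhds
  obtain ⟨t, ht, ht0⟩ :=
    ((h1.eventually (R.isOpen.mem_nhds hz)).and self_mem_nhdsWithin).exists
  have h2 := h _ ht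
  have h3 := h _ hz
  simp [h3] at h2
  exact ht0 h2

/-- The formula for `W` in terms of defect vectors, at the points that need not belong to
`ρ(A₀)`. -/
lemma apply_eq_add {z : ℂ} (hz : z ∈ Z) (v : E) {f : R.A†.domain} (hf : R.A† f = z • (f : H))
    (hfv : star R.B (R.triplet.Γ₀ f) - R.triplet.Γ₁ f = R.K (J v)) :
    W z v = v + (2 * Complex.I) • R.K.adjoint (R.triplet.Γ₀ f) := by
  have hreg : ∀ w ∈ Z, w.im ≠ 0 → ∀ g : R.A†.domain, R.A† g = w • (g : H) →
      star R.B (R.triplet.Γ₀ g) - R.triplet.Γ₁ g = R.K (J v) →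
      W w v = v + (2 * Complex.I) • R.K.adjoint (R.triplet.Γ₀ g) := by
    intro w hw him g hg hgv
    have hw' : w ∈ Z ∩ resolventSet R.triplet.ext₀ :=
      ⟨hw, R.triplet.mem_resolventSet_ext₀ R.isClosedSymmetric him⟩
    have h1 := R.triplet.sub_weyl_apply
      (R.triplet.isWeylAt_weyl_of_im_ne_zero R.isClosedSymmetric him) (star R.B) hg
    rw [hgv] at h1
    have h2 : Ring.inverse (star R.B - R.triplet.weyl w) (R.K (J v)) = R.triplet.Γ₀ g := by
      rw [← h1, inverse_apply_apply (R.isUnit_sub_weyl hw')]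
    rw [R.eq_charValue hw']
    simp [charValue, h2]
  set p : ℝ → ℂ := fun t => z + t * Complex.I with hp
  have hp0 : Filter.Tendsto p (nhdsWithin 0 {0}ᶜ) (nhds z) := by
    have : Continuous p := by fun_prop
    simpa [hp] using (this.tendsto 0).mono_left nhdsWithin_le_nhds
  by_cases him : z.im = 0
  swap
  · exact hreg z hz him f hf hfv
  have hpim : ∀ t : ℝ, (p t).im = t := fun t => by simp [hp, him]
  have hev : ∀ᶠ t in nhdsWithin (0 : ℝ) {0}ᶜ, p t ∈ Z ∧ (p t).im ≠ 0 := by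
    refine (hp0.eventually (R.isOpen.mem_nhds hz)).and ?_
    filter_upwards [self_mem_nhdsWithin] with t ht
    rw [hpim]
    exact ht
  set L := R.triplet.Γ₁ - (star R.B : 𝓗 →L[ℂ] 𝓗).toLinearMap ∘ₗ R.triplet.Γ₀ with hL
  have hLf : ∀ g : R.A†.domain,
      L g = -(star R.B (R.triplet.Γ₀ g) - R.triplet.Γ₁ g) := fun g => by simp [hL]
  have hex : ∀ t, ∃ g : R.A†.domain, p t ∈ Z →
      L g = L f ∧ R.A† g = p t • (g : H) := fun t => by
    by_cases ht : p t ∈ Z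
    · obtain ⟨g, hg⟩ := exists_mem_defect_of_mem_resolventSet
        (R.triplet.surjective_Γ₁_sub (star R.B)) (R.subset_resolventSet ht) (L f)
      exact ⟨g, fun _ => hg⟩
    · exact ⟨0, fun h => absurd h ht⟩
  choose g hg using hex
  obtain ⟨C, hC, hCg⟩ := exists_norm_sub_le_of_mem_resolventSet (R.subset_resolventSet hz) hf
  have hg0 : Filter.Tendsto (fun t => ((g t : R.A†.domain) : H)) (nhdsWithin 0 {0}ᶜ)
      (nhds (f : H)) := by
    rw [tendsto_iff_norm_sub_tendsto_zero]
    have h1 : Filter.Tendsto (fun t => ‖p t - z‖ * C) (nhdsWithin 0 {0}ᶜ) (nhds 0) := by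
      simpa using (tendsto_iff_norm_sub_tendsto_zero.1 hp0).mul_const C
    refine squeeze_zero' (g := fun t => 2 * (‖p t - z‖ * C) * ‖(f : H)‖)
      (Filter.Eventually.of_forall fun t => norm_nonneg _) ?_ ?_
    · filter_upwards [hev, h1.eventually (Iic_mem_nhds (show (0 : ℝ) < 1 / 2 by norm_num))]
        with t ht ht'
      exact hCg _ _ ht' (hg t ht.1).1 (hg t ht.1).2
    · simpa using (h1.const_mul 2).mul_const ‖(f : H)‖
  refine ext_inner_left ℂ fun u => ?_
  have hW : Filter.Tendsto (fun t => ⟪u, W (p t) v⟫_ℂ) (nhdsWithin 0 {0}ᶜ)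
      (nhds ⟪u, W z v⟫_ℂ) := by
    have h1 := (R.differentiableOn.continuousOn.continuousAt (R.isOpen.mem_nhds hz)).tendsto.comp
      hp0
    have h2 : Continuous fun T : E →L[ℂ] E => ⟪u, T v⟫_ℂ := by fun_prop
    exact (h2.tendsto _).comp h1
  obtain ⟨q, hq₁, hq₀⟩ := R.triplet.surjective (R.K u) 0
  have hgreen : ∀ (y : ℂ) (r : R.A†.domain), R.A† r = y • (r : H) →
      ⟪R.K u, R.triplet.Γ₀ r⟫_ℂ = ⟪R.A† q, (r : H)⟫_ℂ - y * ⟪(q : H), (r : H)⟫_ℂ := by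
    intro y r hr
    have := R.triplet.green r q
    rw [hq₁, hq₀, hr, inner_zero_left, inner_smul_right] at this
    linear_combination this
  have hval : ∀ (y : ℂ) (r : R.A†.domain), R.A† r = y • (r : H) →
      ⟪u, v + (2 * Complex.I) • R.K.adjoint (R.triplet.Γ₀ r)⟫_ℂ =
        ⟪u, v⟫_ℂ + 2 * Complex.I * (⟪R.A† q, (r : H)⟫_ℂ - y * ⟪(q : H), (r : H)⟫_ℂ) := by
    intro y r hr
    rw [inner_add_right, inner_smul_right, ContinuousLinearMap.adjoint_inner_right, hgreen y r hr]
  rw [hval z f hf]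
  refine tendsto_nhds_unique hW (Filter.Tendsto.congr' (f₁ := fun t => ⟪u, v⟫_ℂ + 2 * Complex.I *
    (⟪R.A† q, ((g t : R.A†.domain) : H)⟫_ℂ - p t * ⟪(q : H), ((g t : R.A†.domain) : H)⟫_ℂ)) ?_ ?_)
  · filter_upwards [hev] with t ht
    obtain ⟨h1, h2⟩ := hg t ht.1
    rw [hreg (p t) ht.1 ht.2 (g t) h2 ?_, hval _ _ h2]
    rw [hLf, hLf] at h1
    rw [neg_inj.1 h1, hfv]
  · exact tendsto_const_nhds.add (tendsto_const_nhds.mul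
      ((tendsto_const_nhds.inner hg0).sub (hp0.mul (tendsto_const_nhds.inner hg0))))

/-- The norm of `E₋` is equivalent to `‖K ·‖`. -/
lemma exists_norm_toNegPre_le {z : ℂ} (hz : 0 < z.im) :
    ∃ a b, 0 ≤ a ∧ 0 ≤ b ∧ (∀ f, ‖toNegPre (R.imV z) (R.isPositive_imV hz) f‖ ≤ a * ‖R.K f‖) ∧
      ∀ f, ‖R.K f‖ ≤ b * ‖toNegPre (R.imV z) (R.isPositive_imV hz) f‖ := by
  set M := R.triplet.weyl z
  set N : 𝓗 →L[ℂ] 𝓗 := (realPart R.B : 𝓗 →L[ℂ] 𝓗) - M with hN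
  have hM : IsImCoercive M := R.triplet.isImCoercive_weyl R.isClosedSymmetric hz.ne'
  have him : ∀ x, (⟪N x, x⟫_ℂ).im = (⟪x, M x⟫_ℂ).im := by
    intro x
    have h3 : (⟪(realPart R.B : 𝓗 →L[ℂ] 𝓗) x, x⟫_ℂ).im = 0 := by
      have hs : ContinuousLinearMap.adjoint (realPart R.B : 𝓗 →L[ℂ] 𝓗) = realPart R.B :=
        (realPart R.B).2
      rw [← Complex.conj_eq_iff_im, inner_conj_symm]
      conv_rhs => rw [← hs, ContinuousLinearMap.adjoint_inner_left]
    rw [hN, sub_apply, inner_sub_left, Complex.sub_im, h3, ← inner_conj_symm, Complex.conj_im]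
    ring
  have hNu : IsUnit N := by
    obtain ⟨c, hc, h⟩ := hM
    refine N.isUnit_of_forall_le_norm_inner_map (c := ⟨c, hc.le⟩) hc fun x => ?_
    have := Complex.abs_im_le_norm ⟪N x, x⟫_ℂ
    rw [him] at this
    refine le_trans (le_of_eq ?_) ((h x).trans this)
    exact mul_comm _ _
  have hnorm : ∀ f, ‖toNegPre (R.imV z) (R.isPositive_imV hz) f‖ ^ 2 =
      (⟪Ring.inverse N (R.K f), M (Ring.inverse N (R.K f))⟫_ℂ).im := by
    intro f
    rw [norm_toNegPre_sq, ← him, apply_inverse_apply hNu,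
      ← ContinuousLinearMap.adjoint_inner_right R.K]
    change _ = (⟪f, R.V z f⟫_ℂ).im
    have h := inner_sub_star_of_imaginaryPart_eq (B := R.V z) (b := R.imV z) rfl f f
    rw [ContinuousLinearMap.star_eq_adjoint, ContinuousLinearMap.adjoint_inner_right,
      ← inner_conj_symm (R.V z f), Complex.sub_conj] at h
    rw [← inner_conj_symm, Complex.conj_re]
    have h' := congrArg Complex.im h
    simp at h'
    linarith
  obtain ⟨C, hC, h1⟩ := hM.exists_norm_sq_le N
  obtain ⟨C', hC', h2⟩ := exists_abs_im_inner_le M hNu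
  refine ⟨√C', √C, by positivity, by positivity, fun f => ?_, fun f => ?_⟩
  · refine abs_le_of_sq_le_sq' ?_ (by positivity) |>.2
    rw [mul_pow, Real.sq_sqrt hC', hnorm]
    refine (le_abs_self _).trans ((h2 _).trans ?_)
    rw [apply_inverse_apply hNu]
  · refine abs_le_of_sq_le_sq' ?_ (by positivity) |>.2
    rw [mul_pow, Real.sq_sqrt hC]
    have := h1 (Ring.inverse N (R.K f))
    rwa [apply_inverse_apply hNu, ← hnorm, abs_of_nonneg (sq_nonneg _)] at this

end LambdaRepr

end

section Transform

variable {H : Type v} [NormedAddCommGroup H] [InnerProductSpace ℂ H] [CompleteSpace H]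
  {A : H →ₗ.[ℂ] H} {𝓗 : Type w} [NormedAddCommGroup 𝓗] [InnerProductSpace ℂ 𝓗] [CompleteSpace 𝓗]

lemma inner_imaginaryPart_left (B : 𝓗 →L[ℂ] 𝓗) (x y : 𝓗) :
    ⟪(imaginaryPart B : 𝓗 →L[ℂ] 𝓗) x, y⟫_ℂ = ⟪x, (imaginaryPart B : 𝓗 →L[ℂ] 𝓗) y⟫_ℂ := by
  have hs : ContinuousLinearMap.adjoint (imaginaryPart B : 𝓗 →L[ℂ] 𝓗) = imaginaryPart B :=
    (imaginaryPart B).2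
  conv_lhs => rw [← hs, ContinuousLinearMap.adjoint_inner_left]

lemma inner_star_sub_sub_inner (B : 𝓗 →L[ℂ] 𝓗) (x y x' y' : 𝓗) :
    ⟪x', star B x - y⟫_ℂ - ⟪star B x' - y', x⟫_ℂ =
      -(2 * Complex.I * ⟪x', (imaginaryPart B : 𝓗 →L[ℂ] 𝓗) x⟫_ℂ) - ⟪x', y⟫_ℂ + ⟪y', x⟫_ℂ := by
  rw [inner_sub_star_of_imaginaryPart_eq rfl, inner_sub_left, inner_sub_right,
    ContinuousLinearMap.star_eq_adjoint, ContinuousLinearMap.adjoint_inner_left]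
  ring

/-- Invariance of the form in Green's identity, in the coordinates `x = Γ₀ f`,
`y = B* Γ₀ f - Γ₁ f`. -/
lemma inner_transform {B T : 𝓗 →L[ℂ] 𝓗}
    (hT : T + T.adjoint + T ∘L (imaginaryPart B : 𝓗 →L[ℂ] 𝓗) ∘L T.adjoint = 0)
    {x y x' y' s t s' t' : 𝓗}
    (hs : s = x + (Complex.I / 2) • T.adjoint y)
    (ht : t = y + (imaginaryPart B : 𝓗 →L[ℂ] 𝓗) (T.adjoint y))
    (hs' : s' = x' + (Complex.I / 2) • T.adjoint y')
    (ht' : t' = y' + (imaginaryPart B : 𝓗 →L[ℂ] 𝓗) (T.adjoint y')) :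
    ⟪s', star B s - t⟫_ℂ - ⟪star B s' - t', s⟫_ℂ =
      ⟪x', star B x - y⟫_ℂ - ⟪star B x' - y', x⟫_ℂ := by
  rw [inner_star_sub_sub_inner, inner_star_sub_sub_inner]
  have h := congrArg (fun S : 𝓗 →L[ℂ] 𝓗 => ⟪y', S y⟫_ℂ) hT
  simp only [add_apply, ContinuousLinearMap.comp_apply, inner_add_right, zero_apply,
    inner_zero_right] at h
  rw [← ContinuousLinearMap.adjoint_inner_left T, ← ContinuousLinearMap.adjoint_inner_left T] at h
  subst hs ht hs' ht'
  simp only [map_add, map_smul, inner_add_left, inner_add_right, inner_smul_left, inner_smul_right,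
    inner_imaginaryPart_left, map_div₀, Complex.conj_I, Complex.conj_ofNat]
  linear_combination (Complex.I / 2) * h +
    (⟪T.adjoint y', (imaginaryPart B : 𝓗 →L[ℂ] 𝓗) x⟫_ℂ -
      ⟪x', (imaginaryPart B : 𝓗 →L[ℂ] 𝓗) (T.adjoint y)⟫_ℂ +
      Complex.I / 2 * ⟪T.adjoint y', (imaginaryPart B : 𝓗 →L[ℂ] 𝓗) (T.adjoint y)⟫_ℂ) *
      Complex.I_sq

/-- The boundary triplet with `Γ₀' = Γ₀ + (i/2) T* D` and `B* Γ₀' - Γ₁' = (1 + B_I T*) D`, where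
`D = B* Γ₀ - Γ₁`. -/
noncomputable def BoundaryTriplet.transform (P : BoundaryTriplet A 𝓗) (B T : 𝓗 →L[ℂ] 𝓗)
    (h₁ : T + T.adjoint + T ∘L (imaginaryPart B : 𝓗 →L[ℂ] 𝓗) ∘L T.adjoint = 0)
    (h₂ : T + T.adjoint + T.adjoint ∘L (imaginaryPart B : 𝓗 →L[ℂ] 𝓗) ∘L T = 0) :
    BoundaryTriplet A 𝓗 where
  Γ₀ := P.Γ₀ + (Complex.I / 2) • T.adjoint.toLinearMap ∘ₗ ((star B).toLinearMap ∘ₗ P.Γ₀ - P.Γ₁)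
  Γ₁ := (star B).toLinearMap ∘ₗ
      (P.Γ₀ + (Complex.I / 2) • T.adjoint.toLinearMap ∘ₗ ((star B).toLinearMap ∘ₗ P.Γ₀ - P.Γ₁)) -
    (1 + (imaginaryPart B : 𝓗 →L[ℂ] 𝓗) ∘L T.adjoint).toLinearMap ∘ₗ
      ((star B).toLinearMap ∘ₗ P.Γ₀ - P.Γ₁)
  green := fun f g => by
    have h := inner_transform h₁ (x := P.Γ₀ f) (y := star B (P.Γ₀ f) - P.Γ₁ f)
      (x' := P.Γ₀ g) (y' := star B (P.Γ₀ g) - P.Γ₁ g) rfl rfl rfl rfl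
    rw [sub_sub_cancel, sub_sub_cancel] at h
    rw [P.green f g, ← h]
    rfl
  surjective := fun k₁ k₀ => by
    set b : 𝓗 →L[ℂ] 𝓗 := (imaginaryPart B : 𝓗 →L[ℂ] 𝓗)
    set k := star B k₀ - k₁ with hk
    set y := k + b (T k) with hy
    obtain ⟨f, hf₁, hf₀⟩ := P.surjective
      (star B (k₀ - (Complex.I / 2) • T.adjoint y) - y) (k₀ - (Complex.I / 2) • T.adjoint y)
    have h3 : y + b (T.adjoint y) = k := by
      have := congrArg (fun S : 𝓗 →L[ℂ] 𝓗 => b (S k)) h₂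
      simp only [add_apply, ContinuousLinearMap.comp_apply, zero_apply, map_add, map_zero] at this
      rw [hy, map_add, map_add]
      linear_combination (norm := module) this
    refine ⟨f, ?_, ?_⟩
    · change star B (P.Γ₀ f + (Complex.I / 2) • T.adjoint (star B (P.Γ₀ f) - P.Γ₁ f)) -
        ((star B (P.Γ₀ f) - P.Γ₁ f) + b (T.adjoint (star B (P.Γ₀ f) - P.Γ₁ f))) = k₁
      rw [hf₁, hf₀, sub_sub_cancel, sub_add_cancel, h3, hk, sub_sub_cancel]
    · change P.Γ₀ f + (Complex.I / 2) • T.adjoint (star B (P.Γ₀ f) - P.Γ₁ f) = k₀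
      rw [hf₁, hf₀, sub_sub_cancel, sub_add_cancel]

lemma apply_add_imaginaryPart_adjoint {B T : 𝓗 →L[ℂ] 𝓗}
    (h₁ : T + T.adjoint + T ∘L (imaginaryPart B : 𝓗 →L[ℂ] 𝓗) ∘L T.adjoint = 0) {k t : 𝓗}
    (h : k + (imaginaryPart B : 𝓗 →L[ℂ] 𝓗) (T.adjoint k) = t) :
    T t = -T.adjoint k := by
  have := congrArg (fun S : 𝓗 →L[ℂ] 𝓗 => S k) h₁
  simp only [add_apply, ContinuousLinearMap.comp_apply, zero_apply] at this
  rw [← h, map_add]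
  linear_combination (norm := module) this

lemma add_imaginaryPart_eq {B T : 𝓗 →L[ℂ] 𝓗}
    (h₁ : T + T.adjoint + T ∘L (imaginaryPart B : 𝓗 →L[ℂ] 𝓗) ∘L T.adjoint = 0) {k t : 𝓗}
    (h : k + (imaginaryPart B : 𝓗 →L[ℂ] 𝓗) (T.adjoint k) = t) :
    k = t + (imaginaryPart B : 𝓗 →L[ℂ] 𝓗) (T t) := by
  rw [apply_add_imaginaryPart_adjoint h₁ h, ← h, map_neg]
  abel

variable (P : BoundaryTriplet A 𝓗) {B T : 𝓗 →L[ℂ] 𝓗}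
  (h₁ : T + T.adjoint + T ∘L (imaginaryPart B : 𝓗 →L[ℂ] 𝓗) ∘L T.adjoint = 0)
  (h₂ : T + T.adjoint + T.adjoint ∘L (imaginaryPart B : 𝓗 →L[ℂ] 𝓗) ∘L T = 0)

lemma BoundaryTriplet.transform_Γ₀ (f : A†.domain) : (P.transform B T h₁ h₂).Γ₀ f =
    P.Γ₀ f + (Complex.I / 2) • T.adjoint (star B (P.Γ₀ f) - P.Γ₁ f) := rfl

lemma BoundaryTriplet.transform_star_sub (f : A†.domain) :
    star B ((P.transform B T h₁ h₂).Γ₀ f) - (P.transform B T h₁ h₂).Γ₁ f =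
      (star B (P.Γ₀ f) - P.Γ₁ f) +
        (imaginaryPart B : 𝓗 →L[ℂ] 𝓗) (T.adjoint (star B (P.Γ₀ f) - P.Γ₁ f)) :=
  sub_sub_cancel _ _

lemma BoundaryTriplet.transform_ext :
    (P.transform B T h₁ h₂).ext (star B) = P.ext (star B) := by
  have h : LinearMap.ker ((P.transform B T h₁ h₂).Γ₁ -
      ((star B : 𝓗 →L[ℂ] 𝓗) : 𝓗 →ₗ[ℂ] 𝓗) ∘ₗ (P.transform B T h₁ h₂).Γ₀) =
      LinearMap.ker (P.Γ₁ - ((star B : 𝓗 →L[ℂ] 𝓗) : 𝓗 →ₗ[ℂ] 𝓗) ∘ₗ P.Γ₀) := by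
    ext f
    have h3 := P.transform_star_sub h₁ h₂ f
    simp only [LinearMap.mem_ker, LinearMap.sub_apply, LinearMap.comp_apply,
      ContinuousLinearMap.coe_coe]
    rw [← neg_sub, neg_eq_zero, ← neg_sub (star B (P.Γ₀ f)), neg_eq_zero]
    constructor
    · intro h4
      rw [add_imaginaryPart_eq h₁ h3.symm, h4, map_zero, map_zero, add_zero]
    · intro h4
      rw [h3, h4, map_zero, map_zero, add_zero]
  rw [BoundaryTriplet.ext, h]
  rfl

end Transform

section Sufficiency

variable {E : Type u} [NormedAddCommGroup E] [InnerProductSpace ℂ E] [CompleteSpace E]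
  {H : Type v} [NormedAddCommGroup H] [InnerProductSpace ℂ H] [CompleteSpace H]
  {𝓗 : Type w} [NormedAddCommGroup 𝓗] [InnerProductSpace ℂ 𝓗] [CompleteSpace 𝓗]
  {J : E →L[ℂ] E} {Z : Set ℂ} {W : ℂ → E →L[ℂ] E}

lemma star_eq_of_sub_one_mul_eq (hJ : IsSignature J) {K : E →L[ℂ] 𝓗} {X : E →L[ℂ] E}
    {T : 𝓗 →L[ℂ] 𝓗} (hT : (X - 1) * J = K.adjoint ∘L T ∘L K) :
    J * (star X - 1) = K.adjoint ∘L T.adjoint ∘L K := by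
  have := congrArg star hT
  rw [star_mul, hJ.1, star_sub, star_one] at this
  rw [this, ContinuousLinearMap.star_eq_adjoint]
  simp only [ContinuousLinearMap.adjoint_comp, ContinuousLinearMap.adjoint_adjoint]
  rfl

lemma add_adjoint_add_eq_zero (hJ : IsSignature J) {K : E →L[ℂ] 𝓗} (hK : DenseRange K)
    {X : E →L[ℂ] E} (hX : IsJUnitary J X) {T : 𝓗 →L[ℂ] 𝓗}
    (hT : (X - 1) * J = K.adjoint ∘L T ∘L K) :
    T + T.adjoint + T ∘L (K ∘L J ∘L K.adjoint) ∘L T.adjoint = 0 ∧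
      T + T.adjoint + T.adjoint ∘L (K ∘L J ∘L K.adjoint) ∘L T = 0 := by
  have hJ2 := hJ.2
  set Y := (X - 1) * J with hY
  set Y' := J * (star X - 1) with hY'
  have hT' : Y' = K.adjoint ∘L T.adjoint ∘L K := star_eq_of_sub_one_mul_eq hJ hT
  have hXY : X = 1 + Y * J := by rw [hY, mul_assoc, hJ2]; noncomm_ring
  have hXY' : star X = 1 + J * Y' := by rw [hY', ← mul_assoc, hJ2]; noncomm_ring
  have e₁ : Y + Y' + Y * J * Y' = 0 := by
    have := hX.2
    rw [hXY', hXY] at this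
    have h : (1 + Y * J) * J * (1 + J * Y') - J =
        (Y * (J * J) + (J * J) * Y' + Y * (J * J) * J * Y') := by noncomm_ring
    rw [this, sub_self, hJ2, one_mul, mul_one] at h
    exact h.symm
  have e₂ : Y + Y' + Y' * J * Y = 0 := by
    have := hX.1
    rw [hXY', hXY] at this
    have h : J * ((1 + J * Y') * J * (1 + Y * J) - J) * J =
        (J * J) * Y * (J * J) + (J * J) * Y' * (J * J) + (J * J) * Y' * J * Y * (J * J) := by
      noncomm_ring
    simp only [this, sub_self, hJ2, one_mul, mul_one, mul_zero, zero_mul] at h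
    exact h.symm
  rw [hT, hT'] at e₁ e₂
  constructor
  · refine eq_of_adjoint_comp_comp_eq hK ?_
    ext u
    have := congrArg (fun S : E →L[ℂ] E => S u) e₁
    simpa using this
  · refine eq_of_adjoint_comp_comp_eq hK ?_
    ext u
    have := congrArg (fun S : E →L[ℂ] E => S u) e₂
    simpa using this

/-- The representation of `W X`, where `(X - 1) J = K* T K`. -/
noncomputable def LambdaRepr.mulRight (R : LambdaRepr H 𝓗 J Z W) (hJ : IsSignature J)
    {X : E →L[ℂ] E} {T : 𝓗 →L[ℂ] 𝓗} (hT : (X - 1) * J = R.K.adjoint ∘L T ∘L R.K)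
    (h₁ : T + T.adjoint + T ∘L (imaginaryPart R.B : 𝓗 →L[ℂ] 𝓗) ∘L T.adjoint = 0)
    (h₂ : T + T.adjoint + T.adjoint ∘L (imaginaryPart R.B : 𝓗 →L[ℂ] 𝓗) ∘L T = 0) :
    LambdaRepr H 𝓗 J Z (fun z => W z * X) where
  A := R.A
  isClosedSymmetric := R.isClosedSymmetric
  triplet := R.triplet.transform R.B T h₁ h₂
  B := R.B
  K := R.K
  im_B := R.im_B
  isOpen := R.isOpen
  nonempty := R.nonempty
  subset_resolventSet := by
    rw [BoundaryTriplet.transform_ext]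
    exact R.subset_resolventSet
  differentiableOn := R.differentiableOn.mul_const _
  eq_on := fun z hz => by
    set P := R.triplet.transform R.B T h₁ h₂ with hP
    have hres : z ∈ resolventSet (P.ext (star R.B)) := by
      rw [hP, BoundaryTriplet.transform_ext]
      exact R.subset_resolventSet hz.1
    have hunit := P.isUnit_sub_weyl R.isClosedSymmetric hz.2 hres
    ext v
    obtain ⟨f, hf', hf⟩ := exists_mem_defect_of_mem_resolventSet
      (P.surjective_Γ₁_sub (star R.B)) hres (-R.K (J v))
    have ht : star R.B (P.Γ₀ f) - P.Γ₁ f = R.K (J v) := by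
      rw [← neg_inj, ← hf', neg_sub]
      rfl
    have hinv : Ring.inverse (star R.B - P.weyl z) (R.K (J v)) = P.Γ₀ f := by
      rw [← ht, ← P.sub_weyl_apply
        (P.isWeylAt_weyl_of_mem_resolventSet R.isClosedSymmetric hz.2) _ hf,
        inverse_apply_apply hunit]
    rw [hP, R.triplet.transform_star_sub h₁ h₂] at ht
    have hXv : X v = v + R.K.adjoint (T (R.K (J v))) := by
      have := congrArg (fun S : E →L[ℂ] E => S (J v)) hT
      simp [hJ.apply_apply] at this
      rw [← this]
      abel
    have hKX : star R.B (R.triplet.Γ₀ f) - R.triplet.Γ₁ f = R.K (J (X v)) := by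
      rw [add_imaginaryPart_eq h₁ ht, hXv, map_add, map_add, R.im_B]
      rfl
    have hWX := R.apply_eq_add hz.1 (X v) hf hKX
    have hTt := apply_add_imaginaryPart_adjoint h₁ ht
    have hΓ := R.triplet.transform_Γ₀ h₁ h₂ f
    rw [← hP] at hΓ
    change W z (X v) = v + (2 * Complex.I) •
      R.K.adjoint (Ring.inverse (star R.B - P.weyl z) (R.K (J v)))
    rw [hinv, hWX, hΓ, hXv, hTt, map_neg, map_add, map_smul, smul_add, smul_smul,
      show 2 * Complex.I * (Complex.I / 2) = -1 by linear_combination Complex.I_mul_I]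
    module

end Sufficiency

section RiggingLemmas

variable {E : Type u} [NormedAddCommGroup E] [InnerProductSpace ℂ E]
  {G : E →L[ℂ] E} {hG : G.IsPositive}

lemma PosSpace.val_injective : Function.Injective (PosSpace.val G hG) := Subtype.val_injective

lemma PosSpace.norm_inner_val_le (v : PosSpace G hG) (u : E) :
    ‖⟪PosSpace.val G hG v, u⟫_ℂ‖ ≤ ‖v‖ * ‖toNegPre G hG u‖ := by
  rw [← PosSpace.functional_apply]
  exact (PosSpace.functional G hG v).le_opNorm _

lemma PosSpace.norm_le {v : PosSpace G hG} {C : ℝ} (hC : 0 ≤ C)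
    (h : ∀ u, ‖⟪PosSpace.val G hG v, u⟫_ℂ‖ ≤ C * ‖toNegPre G hG u‖) : ‖v‖ ≤ C :=
  (PosSpace.functional G hG v).opNorm_le_bound hC h

/-- A linear map into `E` that is bounded with respect to the norm of `E₊` is a bounded map into
`E₊`. -/
lemma PosSpace.exists_clm {F : Type*} [SeminormedAddCommGroup F] [NormedSpace ℂ F] (Y : F →ₗ[ℂ] E)
    {C : ℝ} (hC : 0 ≤ C) (h : ∀ x u, ‖⟪Y x, u⟫_ℂ‖ ≤ C * ‖x‖ * ‖toNegPre G hG u‖) :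
    ∃ S : F →L[ℂ] PosSpace G hG, ∀ x, PosSpace.val G hG (S x) = Y x := by
  let S : F →ₗ[ℂ] PosSpace G hG :=
    { toFun := fun x => ⟨Y x, ⟨C * ‖x‖, h x⟩⟩
      map_add' := fun x y => PosSpace.val_injective (map_add Y x y)
      map_smul' := fun c x => PosSpace.val_injective (map_smul Y c x) }
  exact ⟨S.mkContinuous C fun x => PosSpace.norm_le (by positivity) (h x), fun x => rfl⟩

variable {𝓗 : Type w} [NormedAddCommGroup 𝓗] [InnerProductSpace ℂ 𝓗] {K : E →L[ℂ] 𝓗} {a b : ℝ}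

lemma PosSpace.norm_val_le (ha : 0 ≤ a) (hKa : ∀ f, ‖toNegPre G hG f‖ ≤ a * ‖K f‖)
    (v : PosSpace G hG) : ‖PosSpace.val G hG v‖ ≤ ‖v‖ * (a * ‖K‖) := by
  refine le_of_sq_le_mul (by positivity) ?_
  set e := PosSpace.val G hG v
  calc ‖e‖ ^ 2 = ‖⟪e, e⟫_ℂ‖ := (norm_inner_self_eq_sq _).symm
    _ ≤ ‖v‖ * ‖toNegPre G hG e‖ := v.norm_inner_val_le _
    _ ≤ ‖v‖ * (a * (‖K‖ * ‖e‖)) := by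
        gcongr
        refine (hKa _).trans ?_
        gcongr
        exact K.le_opNorm _
    _ = _ := by ring

lemma exists_norm_inner_le_of_clm (ha : 0 ≤ a) (hKa : ∀ f, ‖toNegPre G hG f‖ ≤ a * ‖K f‖)
    {Y : E →L[ℂ] E} {S : NegSpace G hG →L[ℂ] PosSpace G hG}
    (hS : ∀ f : E, PosSpace.val G hG (S (toNeg G hG f)) = Y f) :
    ∃ C, 0 ≤ C ∧ ∀ u f, ‖⟪u, Y f⟫_ℂ‖ ≤ C * ‖K u‖ * ‖K f‖ := by
  refine ⟨‖S‖ * a * a, by positivity, fun u f => ?_⟩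
  rw [← norm_inner_symm, ← hS]
  refine (PosSpace.norm_inner_val_le _ _).trans ?_
  have h1 : ‖S (toNeg G hG f)‖ ≤ ‖S‖ * (a * ‖K f‖) := by
    refine (S.le_opNorm _).trans ?_
    gcongr
    rw [toNeg, UniformSpace.Completion.norm_coe]
    exact hKa f
  calc _ ≤ (‖S‖ * (a * ‖K f‖)) * (a * ‖K u‖) := by gcongr; exact hKa u
    _ = _ := by ring

variable [CompleteSpace E] [CompleteSpace 𝓗]

lemma norm_inner_adjoint_le (hKb : ∀ f, ‖K f‖ ≤ b * ‖toNegPre G hG f‖) (k : 𝓗)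
    (u : E) : ‖⟪K.adjoint k, u⟫_ℂ‖ ≤ b * ‖k‖ * ‖toNegPre G hG u‖ := by
  rw [ContinuousLinearMap.adjoint_inner_left]
  calc _ ≤ ‖k‖ * ‖K u‖ := norm_inner_le_norm _ _
    _ ≤ ‖k‖ * (b * ‖toNegPre G hG u‖) := by gcongr; exact hKb u
    _ = _ := by ring

/-- `K* T K` is a bounded operator from `E₋` to `E₊`. -/
lemma exists_clm_negSpace_posSpace (hb : 0 ≤ b) (hKb : ∀ f, ‖K f‖ ≤ b * ‖toNegPre G hG f‖)
    (T : 𝓗 →L[ℂ] 𝓗) : ∃ S : NegSpace G hG →L[ℂ] PosSpace G hG,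
      ∀ f : E, PosSpace.val G hG (S (toNeg G hG f)) = (K.adjoint ∘L T ∘L K) f := by
  obtain ⟨S, hS⟩ := PosSpace.exists_clm (G := G) (hG := hG) K.adjoint.toLinearMap hb
    (norm_inner_adjoint_le hKb)
  let e : E →ₗ[ℂ] NegSpace G hG :=
    (UniformSpace.Completion.toComplL (𝕜 := ℂ) (E := NegPre G hG)).toLinearMap ∘ₗ
      (toNegPre G hG).toLinearMap
  have he : DenseRange e :=
    UniformSpace.Completion.denseRange_coe.comp (toNegPre G hG).surjective.denseRange
      (UniformSpace.Completion.continuous_coe _)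
  have hK : ∀ f, ‖K.toLinearMap f‖ ≤ b * ‖e f‖ := fun f => by
    refine (hKb f).trans (le_of_eq ?_)
    rw [← UniformSpace.Completion.norm_coe]
    rfl
  refine ⟨S ∘L T ∘L K.toLinearMap.extendOfNorm e, fun f => ?_⟩
  have h : K.toLinearMap.extendOfNorm e (toNeg G hG f) = K f :=
    LinearMap.extendOfNorm_eq he ⟨b, hK⟩ f
  simp only [ContinuousLinearMap.comp_apply, h, hS]
  rfl

lemma exists_clm_posSpace (ha : 0 ≤ a) (hb : 0 ≤ b)
    (hKa : ∀ f, ‖toNegPre G hG f‖ ≤ a * ‖K f‖) (hKb : ∀ f, ‖K f‖ ≤ b * ‖toNegPre G hG f‖)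
    {J X : E →L[ℂ] E} (hJ : IsSignature J) {T : 𝓗 →L[ℂ] 𝓗}
    (hT : (X - 1) * J = K.adjoint ∘L T ∘L K) :
    ∃ S : PosSpace G hG →L[ℂ] PosSpace G hG,
      ∀ v, PosSpace.val G hG (S v) = X (PosSpace.val G hG v) := by
  refine PosSpace.exists_clm (X.toLinearMap ∘ₗ PosSpace.val G hG)
    (C := 1 + b * (‖T ∘L K ∘L J‖ * (a * ‖K‖))) (by positivity) fun v u => ?_
  set e := PosSpace.val G hG v
  have hXe : X e = e + K.adjoint ((T ∘L K ∘L J) e) := by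
    have := congrArg (fun S : E →L[ℂ] E => S (J e)) hT
    simp [hJ.apply_apply] at this
    simp [← this]
  change ‖⟪X e, u⟫_ℂ‖ ≤ _
  rw [hXe, inner_add_left]
  have h1 : ‖(T ∘L K ∘L J) e‖ ≤ ‖T ∘L K ∘L J‖ * (‖v‖ * (a * ‖K‖)) := by
    refine ((T ∘L K ∘L J).le_opNorm _).trans ?_
    gcongr
    exact v.norm_val_le ha hKa
  calc _ ≤ ‖v‖ * ‖toNegPre G hG u‖ +
        b * (‖T ∘L K ∘L J‖ * (‖v‖ * (a * ‖K‖))) * ‖toNegPre G hG u‖ := by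
        refine (norm_add_le _ _).trans (add_le_add (v.norm_inner_val_le u) ?_)
        refine (norm_inner_adjoint_le hKb _ u).trans ?_
        gcongr
    _ = _ := by ring

lemma exists_equiv_posSpace (ha : 0 ≤ a) (hb : 0 ≤ b)
    (hKa : ∀ f, ‖toNegPre G hG f‖ ≤ a * ‖K f‖) (hKb : ∀ f, ‖K f‖ ≤ b * ‖toNegPre G hG f‖)
    {J X : E →L[ℂ] E} (hJ : IsSignature J) (hX : IsJUnitary J X) {T : 𝓗 →L[ℂ] 𝓗}
    (hT : (X - 1) * J = K.adjoint ∘L T ∘L K) :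
    ∃ S : PosSpace G hG ≃L[ℂ] PosSpace G hG,
      ∀ v, PosSpace.val G hG (S v) = X (PosSpace.val G hG v) := by
  have hT' : (jAdjoint J X - 1) * J = K.adjoint ∘L T.adjoint ∘L K := by
    rw [← star_eq_of_sub_one_mul_eq hJ hT, jAdjoint, sub_mul, mul_assoc (J * star X), hJ.2]
    noncomm_ring
  obtain ⟨S, hS⟩ := exists_clm_posSpace ha hb hKa hKb hJ hT
  obtain ⟨S', hS'⟩ := exists_clm_posSpace ha hb hKa hKb hJ hT'
  have h : ∀ v, jAdjoint J X (X v) = v := fun v =>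
    congrArg (fun S : E →L[ℂ] E => S v) (hX.jAdjoint_mul hJ)
  have h' : ∀ v, X (jAdjoint J X v) = v := fun v =>
    congrArg (fun S : E →L[ℂ] E => S v) (hX.mul_jAdjoint hJ)
  exact ⟨ContinuousLinearEquiv.equivOfInverse S S'
    (fun v => PosSpace.val_injective (by rw [hS', hS, h]))
    (fun v => PosSpace.val_injective (by rw [hS, hS', h'])), hS⟩

end RiggingLemmas

section Main

variable {E : Type u} [NormedAddCommGroup E] [InnerProductSpace ℂ E] [CompleteSpace E]
  {H : Type v} [NormedAddCommGroup H] [InnerProductSpace ℂ H] [CompleteSpace H]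
  {𝓗 : Type w} [NormedAddCommGroup 𝓗] [InnerProductSpace ℂ 𝓗] [CompleteSpace 𝓗]
  {J : E →L[ℂ] E} {Z : Set ℂ} {W : ℂ → E →L[ℂ] E}

lemma inLambda0_mul_mul_iff (hJ : IsSignature J) {U₁ U₂ : E →L[ℂ] E} (hU₁ : IsJUnitary J U₁) :
    InLambda0.{u, v, w} J Z (fun z => U₁ * W z * U₂) ↔
      InLambda0.{u, v, w} J Z (fun z => W z * (U₂ * U₁)) := by
  have hinv : jAdjoint J (jAdjoint J U₁) = U₁ := by
    rw [jAdjoint, jAdjoint, star_mul, star_mul, star_star, hJ.1]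
    calc _ = (J * J) * U₁ * (J * J) := by noncomm_ring
      _ = _ := by rw [hJ.2, one_mul, mul_one]
  constructor
  · intro h
    have h1 := h.conj hJ (hU₁.jAdjoint hJ)
    rw [hinv] at h1
    refine (congrArg (InLambda0.{u, v, w} J Z) (funext fun z => ?_)).mp h1
    calc _ = (jAdjoint J U₁ * U₁) * W z * (U₂ * U₁) := by simp only [mul_assoc]
      _ = _ := by rw [hU₁.jAdjoint_mul hJ, one_mul]
  · intro h
    refine (congrArg (InLambda0.{u, v, w} J Z) (funext fun z => ?_)).mp (h.conj hJ hU₁)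
    calc _ = U₁ * W z * U₂ * (U₁ * jAdjoint J U₁) := by simp only [mul_assoc]
      _ = _ := by rw [hU₁.mul_jAdjoint hJ, mul_one]

/-- `W X` belongs to `Λ⁰_J` if and only if `(X - 1) J` is bounded with respect to `‖K ·‖`. -/
lemma LambdaRepr.inLambda0_mul_iff [TopologicalSpace.SeparableSpace H] (R : LambdaRepr H 𝓗 J Z W)
    (hJ : IsSignature J) (hK : R.K.adjoint.ker = ⊥) {X : E →L[ℂ] E} (hX : IsJUnitary J X) :
    InLambda0.{u, v, w} J Z (fun z => W z * X) ↔
      ∃ C, 0 ≤ C ∧ ∀ u f, ‖⟪u, ((X - 1) * J) f⟫_ℂ‖ ≤ C * ‖R.K u‖ * ‖R.K f‖ := by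
  constructor
  · rintro ⟨H₁, _, _, _, _, 𝓗₁, _, _, _, R₁, -⟩
    obtain ⟨z, hz, him⟩ := R.exists_im_ne_zero
    have h := R.triplet.mem_resolventSet_ext₀ R.isClosedSymmetric him
    have h₁ := R₁.triplet.mem_resolventSet_ext₀ R₁.isClosedSymmetric him
    refine exists_norm_inner_sub_one_mul_le hJ hX R.im_B R₁.im_B (R.isUnit_sub_weyl ⟨hz, h⟩)
      (R₁.isUnit_sub_weyl ⟨hz, h₁⟩) (R.triplet.isImCoercive_weyl R.isClosedSymmetric him)
      (R₁.triplet.isImCoercive_weyl R₁.isClosedSymmetric him) ?_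
    rw [← R.eq_charValue ⟨hz, h⟩, ← R₁.eq_charValue ⟨hz, h₁⟩]
  · rintro ⟨C, hC, h⟩
    have hdense := denseRange_of_ker_adjoint_eq_bot hK
    obtain ⟨T, hT⟩ := exists_eq_adjoint_comp_comp hdense _ hC h
    obtain ⟨h₁, h₂⟩ := add_adjoint_add_eq_zero hJ hdense hX hT
    rw [← R.im_B] at h₁ h₂
    exact ⟨H, _, _, _, inferInstance, 𝓗, _, _, _, R.mulRight hJ hT h₁ h₂, hK⟩

end Main

end DM

theorem theorem5
    {E : Type u} [NormedAddCommGroup E] [InnerProductSpace ℂ E] [CompleteSpace E]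
    (J : E →L[ℂ] E) (hJ : DM.IsSignature J)
    -- `W₀` is a function of the class `Λ⁰_J` on `Z`, and `R` is any of its representations
    {H : Type v} [NormedAddCommGroup H] [InnerProductSpace ℂ H] [CompleteSpace H]
    [TopologicalSpace.SeparableSpace H]
    {𝓗 : Type w} [NormedAddCommGroup 𝓗] [InnerProductSpace ℂ 𝓗] [CompleteSpace 𝓗]
    (Z : Set ℂ) (W₀ : ℂ → E →L[ℂ] E) (R : DM.LambdaRepr H 𝓗 J Z W₀)
    (hK : R.K.adjoint.ker = ⊥)
    (U₁ U₂ : E →L[ℂ] E) (hU₁ : DM.IsJUnitary J U₁) (hU₂ : DM.IsJUnitary J U₂)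
    -- the point that fixes the norms of `E₊` and `E₋`
    (z₀ : ℂ) (hz₀ : 0 < z₀.im) :
    DM.InLambda0.{u, v, w} J Z (fun z => U₁ * W₀ z * U₂) ↔
      (∃ S : DM.PosSpace (R.imV z₀) (R.isPositive_imV hz₀) ≃L[ℂ]
            DM.PosSpace (R.imV z₀) (R.isPositive_imV hz₀),
          ∀ v, DM.PosSpace.val _ _ (S v) = (U₂ * U₁) (DM.PosSpace.val _ _ v)) ∧
      (∃ T : DM.NegSpace (R.imV z₀) (R.isPositive_imV hz₀) →L[ℂ]
            DM.PosSpace (R.imV z₀) (R.isPositive_imV hz₀),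
          ∀ f : E, DM.PosSpace.val _ _ (T (DM.toNeg _ _ f)) = ((U₂ * U₁ - 1) * J) f) := by

  have hX := hU₂.mul hU₁
  obtain ⟨a, b, ha, hb, hKa, hKb⟩ := R.exists_norm_toNegPre_le hz₀
  rw [DM.inLambda0_mul_mul_iff hJ hU₁, R.inLambda0_mul_iff hJ hK hX]
  constructor
  · rintro ⟨C, hC, h⟩
    obtain ⟨T, hT⟩ := DM.exists_eq_adjoint_comp_comp
      (DM.denseRange_of_ker_adjoint_eq_bot hK) _ hC h
    refine ⟨DM.exists_equiv_posSpace ha hb hKa hKb hJ hX hT, ?_⟩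
    rw [hT]
    exact DM.exists_clm_negSpace_posSpace hb hKb T
  · rintro ⟨-, S, hS⟩
    exact DM.exists_norm_inner_le_of_clm ha hKa hS
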